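/- Consider $n$ rankable objects that appear one at a time, at times $1,\dots,n$, in an order such that all $n!$ permutations are equally likely. Only relative ranks are observed; an object is a *candidate* if it is the best of those that have appeared so far. At most $m$ objects may be selected, one after another, at stopping times of the sequence of relative ranks, and only a candidate may be selected, at the moment it appears. A candidate selected at time $i$ yields $T_n(i)-i$, where $T_n(i)$ is the arrival time of the first candidate after time $i$ (and $T_n(i)=n+1$ if there is none), and each selection incurs an acquisition cost $c(n)$. Let $q_m(n)$ be the supremum, over all such selection strategies, of the expected total net payoff. Suppose that $c(n)/n\to c$ as $n\to\infty$, where $0<c\le e^{-1}$. Then the equation $-x\ln x=c$ has a unique root $\beta$ in $[e^{-1},1)$ and a unique root $\beta'$ in $(0,e^{-1}]$; for every $m$ the limit $q_m^*=\lim_{n\to\infty} q_m(n)/n$ exists; and $q_m^*$ converges as $m\to\infty$ to $$q_\infty^*=(\beta-\beta')\left(1-\frac{c^2}{\beta\beta'}\right).$$ -/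

import Mathlib

/-!
The multiple-choice duration problem with acquisition cost.

`n` rankable objects appear one at a time, in a uniformly random order.  An outcome is a
permutation `σ` of `Fin n`: the object that appears at the time with (zero-based) index `i` has
absolute rank `σ i`, and `0` is the best rank.  Only relative ranks are observed.
-/

namespace DurationProblem

/-- The relative rank, among the objects observed so far, of the object that appears at time `i`
(relative rank `1` is the best). -/
def relRank {n : ℕ} (σ : Equiv.Perm (Fin n)) (i : Fin n) : ℕ :=
  (Finset.univ.filter fun j : Fin n => j ≤ i ∧ σ j ≤ σ i).card

/-- The object that appears at time `i` is a candidate if it is relatively best. -/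
def IsCandidate {n : ℕ} (σ : Equiv.Perm (Fin n)) (i : Fin n) : Prop :=
  relRank σ i = 1

/-- The arrival time of the first candidate after time `i` if there is one, and the time `n` just
after the last arrival (times are numbered `0, …, n - 1`) if there is none. -/
noncomputable def nextCandidate {n : ℕ} (σ : Equiv.Perm (Fin n)) (i : Fin n) : ℕ :=
  sInf {t : ℕ | t = n ∨ ∃ j : Fin n, i < j ∧ IsCandidate σ j ∧ t = (j : ℕ)}

/-- The time during which a candidate selected at time `i` stays relatively best. -/
noncomputable def duration {n : ℕ} (σ : Equiv.Perm (Fin n)) (i : Fin n) : ℝ :=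
  (nextCandidate σ i : ℝ) - (i : ℝ)

/-- The information available at time `i`: the σ-algebra generated by the relative ranks of the
objects that have appeared up to and including time `i`. -/
def rankFiltration (n : ℕ) :
    MeasureTheory.Filtration (Fin n) (⊤ : MeasurableSpace (Equiv.Perm (Fin n))) where
  seq i := MeasurableSpace.comap
    (fun (σ : Equiv.Perm (Fin n)) (j : {j : Fin n // j ≤ i}) => relRank σ j.1) ⊤
  mono' := by
    intro i k hik s hs
    obtain ⟨t, -, rfl⟩ := hs
    exact ⟨(fun x (j : {j : Fin n // j ≤ i}) => x ⟨j.1, j.2.trans hik⟩) ⁻¹' t,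
      MeasurableSpace.measurableSet_top, rfl⟩
  le' := fun _ => le_top

/-- Stopping vectors for at most `m` choices: `τ k` is the time of the choice number `k + 1`, with
value `⊤` if that choice is never made.  Each `τ k` is a stopping time with respect to the observed
relative ranks, successive choices are made at strictly increasing times, and only candidates can
be chosen. -/
structure IsStoppingVector {n m : ℕ} (τ : Fin m → Equiv.Perm (Fin n) → WithTop (Fin n)) :
    Prop where
  isStoppingTime : ∀ k, MeasureTheory.IsStoppingTime (rankFiltration n) (τ k)
  increasing : ∀ k l, k < l → ∀ σ, τ l σ ≠ ⊤ → τ k σ < τ l σ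
  candidate : ∀ k σ (i : Fin n), τ k σ = (i : WithTop (Fin n)) → IsCandidate σ i

/-- The net payoff of a single choice with acquisition cost `c`: the possession time less the cost
if the choice is made, and `0` if it is not made. -/
noncomputable def choicePayoff {n : ℕ} (c : ℝ) (σ : Equiv.Perm (Fin n)) : WithTop (Fin n) → ℝ
  | ⊤ => 0
  | (i : Fin n) => duration σ i - c

/-- The expected net payoff of a stopping vector, all `n!` orders being equally likely. -/
noncomputable def expectedNetPayoff {n m : ℕ} (c : ℝ)
    (τ : Fin m → Equiv.Perm (Fin n) → WithTop (Fin n)) : ℝ :=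
  (∑ σ : Equiv.Perm (Fin n), ∑ k : Fin m, choicePayoff c σ (τ k σ)) / (n.factorial : ℝ)

/-- The optimal expected net payoff of the `m`-choice problem with `n` objects and acquisition
cost `c`: the supremum over all stopping vectors (a finite nonempty set). -/
noncomputable def optimalNetPayoff (n m : ℕ) (c : ℝ) : ℝ :=
  sSup {v : ℝ | ∃ τ : Fin m → Equiv.Perm (Fin n) → WithTop (Fin n),
    IsStoppingVector τ ∧ v = expectedNetPayoff c τ}

end DurationProblem

/-! ### Relative ranks as independent uniform coordinates -/

namespace DurationProblem

open Finset

/-! The relative ranks of a uniform permutation are independent, the one at index `i` being uniform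
on `i + 1` values (`rankCode_bijective`). So a candidate appears at `i` with probability `1 / (i +
1)` independently of the past, and its expected duration is `(i + 1) * ∑ 1 / (t + 1)`, close to `-n
x log x` at `x = (i + 1) / n`. A potential argument identifies the optimum over stopping vectors
with the backward recursion `value` (`optimalNetPayoff_eq_value`).

Divided by `n`, the recursion is a backward Euler scheme for `v_l' = -max 0 (G + v_{l-1} - v_l) / x`
with `v_l 1 = 0` and `G x = -x log x - c`, so for each `l` the values converge on `[δ, 1]`
(`gridConverges_of_recursion`). The singularity at `0` does no harm: `G < 0` on `(0, β')`, so for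
fixed `δ < β'` choices before time `δ n` eventually do not pay (`eventually_optimalNetPayoff_eq`).

With unlimited choices, taking a candidate costs no later opportunity, so the scaled limit is the
integral of `max 0 G / y`, which is explicit (`integral_max_div_eq`). The deficit with `l` choices
is at most the unlimited value times `S ^ l / l!` (`unlimitedValue_sub_value_le`), where `S` is the
harmonic sum from `δ n` to `n`. Since `S` is bounded uniformly in `n`, the estimate survives `n → ∞`
and then forces convergence as `l → ∞`. -/

/-- Permutations whose relative ranks agree before time `i` have the same order pattern on the
objects that appear before time `i`. -/
lemma le_iff_le_of_relRank_eq {n : ℕ} {σ τ : Equiv.Perm (Fin n)} (i : ℕ)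
    (h : ∀ j : Fin n, (j : ℕ) < i → relRank σ j = relRank τ j) :
    ∀ j k : Fin n, (j : ℕ) < i → (k : ℕ) < i → (σ j ≤ σ k ↔ τ j ≤ τ k) := by
  induction i with
  | zero => intro j k hj; omega
  | succ i ih =>
    have ih' := ih fun j hj => h j (by omega)
    have key : ∀ a b : Fin n, (a : ℕ) < i → (b : ℕ) = i → (σ a ≤ σ b ↔ τ a ≤ τ b) := by
      intro a b ha hb
      have hcard := h b (by omega)
      unfold relRank at hcard
      by_contra hne
      -- If `a` lies below `b` under `σ` but above it under `τ`, every object counted by the rank of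
      -- `b` under `τ` is also counted under `σ`, and `a` is an extra one; so the ranks of `b`
      -- differ.
      have hsub : ∀ (σ τ : Equiv.Perm (Fin n)),
          (∀ j k : Fin n, (j : ℕ) < i → (k : ℕ) < i → (σ j ≤ σ k ↔ τ j ≤ τ k)) →
          σ a ≤ σ b → ¬ τ a ≤ τ b →
          (univ.filter fun j : Fin n => j ≤ b ∧ τ j ≤ τ b).card <
            (univ.filter fun j : Fin n => j ≤ b ∧ σ j ≤ σ b).card := by
        intro σ τ hστ h1 h2
        apply Finset.card_lt_card
        rw [Finset.ssubset_iff_of_subset]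
        · refine ⟨a, ?_, ?_⟩
          · simp only [mem_filter, mem_univ, true_and]
            exact ⟨by rw [Fin.le_def]; omega, h1⟩
          · simp only [mem_filter, mem_univ, true_and, not_and]
            exact fun _ => h2
        · intro j hj
          simp only [mem_filter, mem_univ, true_and] at hj ⊢
          refine ⟨hj.1, ?_⟩
          rcases eq_or_ne j b with rfl | hjb
          · exact le_rfl
          · have hji : (j : ℕ) < i := by
              have := hj.1
              have h3 : (j : ℕ) ≠ b := fun h => hjb (Fin.ext h)
              rw [Fin.le_def] at this
              omega
            exact ((hστ j a hji ha).2 (hj.2.trans (not_le.1 h2).le)).trans h1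
      by_cases h1 : σ a ≤ σ b
      · have h2 : ¬ τ a ≤ τ b := fun h2 => hne ⟨fun _ => h2, fun _ => h1⟩
        exact absurd hcard (hsub σ τ ih' h1 h2).ne'
      · have h2 : τ a ≤ τ b := by
          by_contra h2
          exact hne ⟨fun h => absurd h h1, fun h => absurd h h2⟩
        exact absurd hcard (hsub τ σ (fun j k hj hk => (ih' j k hj hk).symm) h2 h1).ne
    intro j k hj hk
    rcases Nat.lt_succ_iff_lt_or_eq.1 hj with hj | hj <;>
      rcases Nat.lt_succ_iff_lt_or_eq.1 hk with hk | hk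
    · exact ih' j k hj hk
    · exact key j k hj hk
    · rcases eq_or_ne j k with rfl | hjk
      · simp
      · have := key k j hk hj
        have h1 : σ k ≠ σ j := fun h => hjk (σ.injective h).symm
        have h2 : τ k ≠ τ j := fun h => hjk (τ.injective h).symm
        rw [← not_lt, ← not_lt, lt_iff_le_and_ne, lt_iff_le_and_ne, this]
        simp [h1, h2]
    · have : j = k := Fin.ext (by omega)
      subst this; simp

/-- Equal ranks give equal order patterns, so `σ.symm.trans τ` is an order automorphism of `Fin n`,
hence the identity. -/
theorem relRank_injective (n : ℕ) :
    Function.Injective fun (σ : Equiv.Perm (Fin n)) (i : Fin n) => relRank σ i := by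
  intro σ τ h
  have hle := le_iff_le_of_relRank_eq (σ := σ) (τ := τ) n fun j _ => congrFun h j
  let e : Fin n ≃o Fin n :=
    { toEquiv := σ.symm.trans τ
      map_rel_iff' := by
        intro a b
        have := hle (σ.symm a) (σ.symm b) (Fin.is_lt _) (Fin.is_lt _)
        simpa using this.symm }
  have he : e = OrderIso.refl _ := Subsingleton.elim _ _
  ext1 x
  have h1 : e (σ x) = σ x := by rw [he]; rfl
  have h2 : e (σ x) = τ x := by simp [e]
  rw [← h1, h2]

lemma relRank_pos {n : ℕ} (σ : Equiv.Perm (Fin n)) (i : Fin n) : 0 < relRank σ i :=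
  Finset.card_pos.2 ⟨i, by simp⟩

lemma relRank_le {n : ℕ} (σ : Equiv.Perm (Fin n)) (i : Fin n) : relRank σ i ≤ i + 1 := by
  unfold relRank
  calc _ ≤ (Finset.Iic i).card := Finset.card_le_card fun j => by simp +contextual
    _ = i + 1 := by simp

/-- The sequence of relative ranks (shifted to start from `0`) of a permutation. -/
def rankCode {n : ℕ} (σ : Equiv.Perm (Fin n)) (i : Fin n) : Fin (i + 1) :=
  ⟨relRank σ i - 1, by have := relRank_pos σ i; have := relRank_le σ i; omega⟩

lemma rankCode_eq_zero_iff {n : ℕ} {σ : Equiv.Perm (Fin n)} {i : Fin n} :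
    rankCode σ i = 0 ↔ IsCandidate σ i := by
  have := relRank_pos σ i
  rw [Fin.ext_iff, IsCandidate]
  simp only [rankCode, Fin.val_zero]
  omega

lemma relRank_eq_of_rankCode_eq {n : ℕ} {σ τ : Equiv.Perm (Fin n)} {i : Fin n}
    (h : rankCode σ i = rankCode τ i) : relRank σ i = relRank τ i := by
  have h1 := relRank_pos σ i
  have h2 := relRank_pos τ i
  rw [Fin.ext_iff] at h
  simp only [rankCode] at h
  omega

/-- Injectivity suffices because both sides have `n !` elements. Sums over permutations thereby
become sums over a product, which is the independence of the relative ranks. -/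
theorem rankCode_bijective (n : ℕ) :
    Function.Bijective
      (rankCode : Equiv.Perm (Fin n) → (i : Fin n) → Fin (i + 1)) := by
  rw [Fintype.bijective_iff_injective_and_card]
  constructor
  · intro σ τ h
    exact relRank_injective n (funext fun i => relRank_eq_of_rankCode_eq (congrFun h i))
  · rw [Fintype.card_perm, Fintype.card_pi]
    simp only [Fintype.card_fin]
    rw [Fin.prod_univ_eq_prod_range (fun i => i + 1) n, Finset.prod_range_add_one_eq_factorial]

/-- `f` depends only on the relative ranks of the objects that appear before time `i`. -/
def DeterminedBefore {n : ℕ} {α : Type*} (i : ℕ) (f : Equiv.Perm (Fin n) → α) : Prop :=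
  ∀ σ τ : Equiv.Perm (Fin n), (∀ j : Fin n, (j : ℕ) < i → relRank σ j = relRank τ j) → f σ = f τ

lemma DeterminedBefore.mono {n : ℕ} {α : Type*} {i j : ℕ} {f : Equiv.Perm (Fin n) → α}
    (hf : DeterminedBefore i f) (hij : i ≤ j) : DeterminedBefore j f :=
  fun σ τ h => hf σ τ fun k hk => h k (hk.trans_le hij)

open Classical in
/-- The event that there is a candidate at time `i` has probability `1 / (i + 1)` and is independent
of the relative ranks observed before. -/
theorem sum_ite_isCandidate {n : ℕ} (i : Fin n) {f : Equiv.Perm (Fin n) → ℝ}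
    (hf : DeterminedBefore i f) :
    ∑ σ, (if IsCandidate σ i then f σ else 0) = (∑ σ, f σ) / ((i : ℝ) + 1) := by
  let e := Equiv.ofBijective _ (rankCode_bijective n)
  have he : ∀ ω j, rankCode (e.symm ω) j = ω j := fun ω j => congrFun (e.apply_symm_apply ω) j
  -- Isolate coordinate `i` of the code: `f` ignores it, and being a candidate selects exactly one
  -- of its `i + 1` values.
  let s := Equiv.piSplitAt i fun j : Fin n => Fin (j + 1)
  have hs : ∀ a y, s.symm (a, y) i = a := fun a y => by simp [s, Equiv.piSplitAt]
  have hs' : ∀ a y (j : Fin n) (hj : j ≠ i), s.symm (a, y) j = y ⟨j, hj⟩ :=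
    fun a y j hj => by simp [s, Equiv.piSplitAt, hj]
  have hF : ∀ a y, f (e.symm (s.symm (a, y))) = f (e.symm (s.symm (0, y))) := by
    intro a y
    apply hf
    intro j hj
    apply relRank_eq_of_rankCode_eq
    have hji : j ≠ i := by rintro rfl; omega
    rw [he, he, hs' _ _ _ hji, hs' _ _ _ hji]
  have h1 : ∀ g : Equiv.Perm (Fin n) → ℝ,
      ∑ σ, g σ = ∑ a, ∑ y, g (e.symm (s.symm (a, y))) := by
    intro g
    rw [← Equiv.sum_comp e.symm g, ← Equiv.sum_comp s.symm, Fintype.sum_prod_type]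
  rw [h1, h1, Finset.sum_comm]
  have h2 : ∀ a y, IsCandidate (e.symm (s.symm (a, y))) i ↔ a = 0 := by
    intro a y
    rw [← rankCode_eq_zero_iff, he, hs]
  simp only [h2, hF]
  have : ((i : ℝ) + 1) ≠ 0 := by positivity
  simp
  field_simp

end DurationProblem

/-! ### Expected duration and the dynamic programming recursion -/

namespace DurationProblem

open Finset

lemma determinedBefore_isCandidate {n : ℕ} (i : Fin n) :
    DeterminedBefore ((i : ℕ) + 1) fun σ => IsCandidate σ i := by
  intro σ τ h
  simp only [IsCandidate, h i (Nat.lt_succ_self _)]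

lemma lt_nextCandidate_iff {n : ℕ} (σ : Equiv.Perm (Fin n)) (i : Fin n) {t : ℕ} (ht : t < n) :
    t < nextCandidate σ i ↔ ∀ j : Fin n, i < j → (j : ℕ) ≤ t → ¬ IsCandidate σ j := by
  constructor
  · intro h j hij hjt hj
    have := Nat.sInf_le (s := {t : ℕ | t = n ∨ ∃ j : Fin n, i < j ∧ IsCandidate σ j ∧ t = (j : ℕ)})
      (Or.inr ⟨j, hij, hj, rfl⟩)
    unfold nextCandidate at h
    omega
  · intro h
    have hmem := Nat.sInf_mem
      (s := {t : ℕ | t = n ∨ ∃ j : Fin n, i < j ∧ IsCandidate σ j ∧ t = (j : ℕ)}) ⟨n, Or.inl rfl⟩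
    change nextCandidate σ i = n ∨ ∃ j : Fin n, i < j ∧ IsCandidate σ j ∧
      nextCandidate σ i = (j : ℕ) at hmem
    rcases hmem with h1 | ⟨j, hij, hj, h1⟩
    · omega
    · by_contra h2
      exact h j hij (by omega) hj

lemma nextCandidate_le {n : ℕ} (σ : Equiv.Perm (Fin n)) (i : Fin n) : nextCandidate σ i ≤ n :=
  Nat.sInf_le (Or.inl rfl)

lemma lt_nextCandidate {n : ℕ} (σ : Equiv.Perm (Fin n)) (i : Fin n) :
    (i : ℕ) < nextCandidate σ i := by
  rw [lt_nextCandidate_iff σ i i.is_lt]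
  intro j hij hji
  rw [Fin.lt_def] at hij
  omega

-- Layer-cake form: `duration` counts the times `t` up to which no new candidate has arrived, and
-- each such event has a computable probability.
open Classical in
lemma duration_eq_sum {n : ℕ} (σ : Equiv.Perm (Fin n)) (i : Fin n) :
    duration σ i = ∑ t ∈ Ico (i : ℕ) n,
      if ∀ j : Fin n, i < j → (j : ℕ) ≤ t → ¬ IsCandidate σ j then (1 : ℝ) else 0 := by
  have h1 := lt_nextCandidate σ i
  have h2 := nextCandidate_le σ i
  rw [← Finset.sum_filter, Finset.sum_const, nsmul_eq_mul, mul_one, duration]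
  have : (Ico (i : ℕ) n).filter (fun t => ∀ j : Fin n, i < j → (j : ℕ) ≤ t → ¬ IsCandidate σ j)
      = Ico (i : ℕ) (nextCandidate σ i) := by
    ext t
    simp only [mem_filter, mem_Ico]
    constructor
    · rintro ⟨⟨h3, h4⟩, h5⟩
      exact ⟨h3, (lt_nextCandidate_iff σ i h4).2 h5⟩
    · rintro ⟨h3, h4⟩
      have h5 : t < n := by omega
      exact ⟨⟨h3, h5⟩, (lt_nextCandidate_iff σ i h5).1 h4⟩
  rw [this, Nat.card_Ico, Nat.cast_sub h1.le]

-- The factor is the telescoping product of the probabilities `s / (s + 1)` of no candidate at `s`,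
-- for `i < s ≤ t`; by independence it does not interact with `f`.
open Classical in
lemma sum_ite_no_candidate {n : ℕ} (i : Fin n) {f : Equiv.Perm (Fin n) → ℝ}
    (hf : DeterminedBefore ((i : ℕ) + 1) f) (t : ℕ) (hit : (i : ℕ) ≤ t) (ht : t < n) :
    ∑ σ, (if ∀ j : Fin n, i < j → (j : ℕ) ≤ t → ¬ IsCandidate σ j then f σ else 0) =
      (∑ σ, f σ) * (((i : ℝ) + 1) / ((t : ℝ) + 1)) := by
  induction t, hit using Nat.le_induction with
  | base =>
    rw [div_self (by positivity), mul_one]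
    refine Finset.sum_congr rfl fun σ _ => if_pos fun j hij hji => ?_
    rw [Fin.lt_def] at hij
    omega
  | succ t hit ih =>
    have ih := ih (by omega)
    set F : Equiv.Perm (Fin n) → ℝ :=
      fun σ => if ∀ j : Fin n, i < j → (j : ℕ) ≤ t → ¬ IsCandidate σ j then f σ else 0 with hF
    have hFd : DeterminedBefore ((⟨t + 1, ht⟩ : Fin n) : ℕ) F := by
      intro σ τ h
      have h1 : f σ = f τ := hf σ τ fun j hj => h j (by simp only; omega)
      have h2 : (∀ j : Fin n, i < j → (j : ℕ) ≤ t → ¬ IsCandidate σ j) ↔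
          (∀ j : Fin n, i < j → (j : ℕ) ≤ t → ¬ IsCandidate τ j) := by
        refine forall_congr' fun j => forall_congr' fun _ => forall_congr' fun hjt => ?_
        have := determinedBefore_isCandidate j σ τ fun k hk => h k (by simp only; omega)
        simp only [eq_iff_iff] at this
        rw [this]
      simp only [hF, h1, h2]
    have key := sum_ite_isCandidate ⟨t + 1, ht⟩ hFd
    have hsplit : ∀ σ, (if ∀ j : Fin n, i < j → (j : ℕ) ≤ t + 1 → ¬ IsCandidate σ j
        then f σ else 0) = F σ - (if IsCandidate σ ⟨t + 1, ht⟩ then F σ else 0) := by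
      intro σ
      have h2 : (∀ j : Fin n, i < j → (j : ℕ) ≤ t + 1 → ¬ IsCandidate σ j) ↔
          (∀ j : Fin n, i < j → (j : ℕ) ≤ t → ¬ IsCandidate σ j) ∧
            ¬ IsCandidate σ ⟨t + 1, ht⟩ := by
        constructor
        · intro h
          exact ⟨fun j hij hjt => h j hij (by omega), h _ (by rw [Fin.lt_def]; simp only; omega)
            le_rfl⟩
        · rintro ⟨h3, h4⟩ j hij hjt
          rcases Nat.le_succ_iff.1 hjt with h5 | h5
          · exact h3 j hij h5
          · have : j = ⟨t + 1, ht⟩ := Fin.ext h5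
            rwa [this]
      simp only [hF, h2]
      by_cases h5 : IsCandidate σ ⟨t + 1, ht⟩ <;> simp [h5]
    rw [Finset.sum_congr rfl fun σ _ => hsplit σ, Finset.sum_sub_distrib, key, ih]
    push_cast
    have h6 : ((t : ℝ) + 1) ≠ 0 := by positivity
    have h7 : ((t : ℝ) + 1 + 1) ≠ 0 := by positivity
    field_simp
    ring

/-- The expected possession time of a candidate that is chosen at time `i`. -/
noncomputable def expectedDuration (n i : ℕ) : ℝ :=
  ∑ t ∈ Ico i n, ((i : ℝ) + 1) / ((t : ℝ) + 1)

open Classical in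
theorem sum_ite_duration {n : ℕ} (i : Fin n) (c : ℝ) {p : Equiv.Perm (Fin n) → Prop}
    (hp : DeterminedBefore ((i : ℕ) + 1) p) :
    ∑ σ, (if p σ then duration σ i - c else 0) =
      ∑ σ, (if p σ then expectedDuration n i - c else 0) := by
  set f : Equiv.Perm (Fin n) → ℝ := fun σ => if p σ then 1 else 0 with hf
  have hfd : DeterminedBefore ((i : ℕ) + 1) f := fun σ τ h => by
    simp only [hf, hp σ τ h]
  have h1 : ∑ σ, f σ * duration σ i = (∑ σ, f σ) * expectedDuration n i := by
    simp only [duration_eq_sum, Finset.mul_sum, expectedDuration]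
    rw [Finset.sum_comm]
    refine Finset.sum_congr rfl fun t ht => ?_
    rw [mem_Ico] at ht
    rw [← sum_ite_no_candidate i hfd t ht.1 ht.2]
    simp
  have h2 : ∀ a : Equiv.Perm (Fin n) → ℝ, ∀ σ, (if p σ then a σ - c else 0) =
      f σ * a σ - f σ * c := by
    intro a σ
    by_cases h : p σ <;> simp [hf, h]
  rw [Finset.sum_congr rfl fun σ _ => h2 (fun σ => duration σ i) σ,
    Finset.sum_congr rfl fun σ _ => h2 (fun σ => expectedDuration n i) σ,
    Finset.sum_sub_distrib, Finset.sum_sub_distrib, h1, Finset.sum_mul]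

/-- The number of choices made before time `i` by a selection rule `χ`. -/
noncomputable def choiceCount {n : ℕ} (χ : Fin n → Equiv.Perm (Fin n) → Prop) (i : ℕ)
    (σ : Equiv.Perm (Fin n)) : ℕ :=
  open Classical in (univ.filter fun j : Fin n => (j : ℕ) < i ∧ χ j σ).card

/-- A selection rule says, for each time `i`, on which event the object appearing at time `i` is
chosen; it uses observed information only, chooses only candidates, and makes at most `m`
choices. -/
structure IsSelectionRule {n : ℕ} (m : ℕ) (χ : Fin n → Equiv.Perm (Fin n) → Prop) : Prop where
  determined : ∀ i : Fin n, DeterminedBefore ((i : ℕ) + 1) (χ i)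
  candidate : ∀ i σ, χ i σ → IsCandidate σ i
  count_le : ∀ σ, choiceCount χ n σ ≤ m

open Classical in
lemma choiceCount_succ {n : ℕ} (χ : Fin n → Equiv.Perm (Fin n) → Prop) (i : Fin n)
    (σ : Equiv.Perm (Fin n)) :
    choiceCount χ (i + 1) σ = choiceCount χ i σ + if χ i σ then 1 else 0 := by
  unfold choiceCount
  have : (univ.filter fun j : Fin n => (j : ℕ) < i + 1 ∧ χ j σ) =
      (univ.filter fun j : Fin n => (j : ℕ) < i ∧ χ j σ) ∪ if χ i σ then {i} else ∅ := by
    ext j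
    by_cases hj : j = i
    · subst hj
      by_cases h : χ j σ <;> simp [h]
    · have h1 : (j : ℕ) ≠ i := fun h => hj (Fin.ext h)
      by_cases h : χ i σ <;> simp [h, hj, h1, le_iff_lt_or_eq]
  rw [this, Finset.card_union_of_disjoint]
  · by_cases h : χ i σ <;> simp [h]
  · by_cases h : χ i σ <;> simp [h]

lemma choiceCount_zero {n : ℕ} (χ : Fin n → Equiv.Perm (Fin n) → Prop)
    (σ : Equiv.Perm (Fin n)) : choiceCount χ 0 σ = 0 := by
  simp [choiceCount]

lemma choiceCount_mono {n : ℕ} (χ : Fin n → Equiv.Perm (Fin n) → Prop)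
    (σ : Equiv.Perm (Fin n)) {i j : ℕ} (hij : i ≤ j) : choiceCount χ i σ ≤ choiceCount χ j σ := by
  classical
  exact Finset.card_le_card fun k hk => by
    simp only [mem_filter, mem_univ, true_and] at hk ⊢
    exact ⟨hk.1.trans_le hij, hk.2⟩

lemma determinedBefore_choiceCount {n : ℕ} {χ : Fin n → Equiv.Perm (Fin n) → Prop}
    (hχ : ∀ i : Fin n, DeterminedBefore ((i : ℕ) + 1) (χ i)) (i : ℕ) :
    DeterminedBefore i (choiceCount χ i) := by
  classical
  intro σ τ h
  unfold choiceCount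
  congr 1
  ext j
  simp only [mem_filter, mem_univ, true_and]
  refine and_congr_right fun hj => ?_
  rw [hχ j σ τ fun k hk => h k (by omega)]

/-- The optimal expected net payoff from the last `j` of `n` objects if at most `l` choices can
still be made and a choice at time `i` yields `g i`. -/
noncomputable def remainingValue (g : ℕ → ℝ) (n : ℕ) : ℕ → ℕ → ℝ
  | 0, _ => 0
  | _ + 1, 0 => 0
  | j + 1, l + 1 => remainingValue g n j (l + 1) +
      max 0 (g (n - (j + 1)) + remainingValue g n j l - remainingValue g n j (l + 1)) /
        (((n - (j + 1) : ℕ) : ℝ) + 1)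

/-- The optimal expected net payoff from time `i` on if at most `l` choices can still be made. -/
noncomputable def value (g : ℕ → ℝ) (n l i : ℕ) : ℝ := remainingValue g n (n - i) l

lemma value_end (g : ℕ → ℝ) (n l : ℕ) : value g n l n = 0 := by
  simp [value, remainingValue]

lemma value_zero (g : ℕ → ℝ) (n i : ℕ) : value g n 0 i = 0 := by
  unfold value
  cases n - i <;> simp [remainingValue]

lemma value_succ (g : ℕ → ℝ) {n i : ℕ} (l : ℕ) (hi : i < n) :
    value g n (l + 1) i = value g n (l + 1) (i + 1) +
      max 0 (g i + value g n l (i + 1) - value g n (l + 1) (i + 1)) / ((i : ℝ) + 1) := by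
  obtain ⟨j, rfl⟩ := Nat.exists_eq_add_of_lt hi
  have h1 : i + j + 1 - i = j + 1 := by omega
  have h2 : i + j + 1 - (i + 1) = j := by omega
  have h3 : i + j + 1 - (j + 1) = i := by omega
  simp only [value, h1, h2, remainingValue, h3]

/-- The advantage of choosing a candidate at time `i` over not choosing it. -/
noncomputable def gain (g : ℕ → ℝ) (n : ℕ) : ℕ → ℕ → ℝ
  | 0, _ => 0
  | l + 1, i => max 0 (g i + value g n l (i + 1) - value g n (l + 1) (i + 1))

lemma value_eq_add_gain (g : ℕ → ℝ) {n i : ℕ} (l : ℕ) (hi : i < n) :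
    value g n l i = value g n l (i + 1) + gain g n l i / ((i : ℝ) + 1) := by
  cases l with
  | zero => simp [value_zero, gain]
  | succ l => exact value_succ g l hi

lemma gain_nonneg (g : ℕ → ℝ) (n l i : ℕ) : 0 ≤ gain g n l i := by
  cases l with
  | zero => exact le_rfl
  | succ l => exact le_max_left _ _

-- The number of earlier choices is independent of whether a candidate appears at `i`. Under the
-- sum, the factor `1 / (i + 1)` of the recursion can therefore be traded for the indicator of a
-- candidate.
open Classical in
lemma sum_value_eq {n : ℕ} (g : ℕ → ℝ) (m : ℕ) {χ : Fin n → Equiv.Perm (Fin n) → Prop}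
    (hχ : ∀ i : Fin n, DeterminedBefore ((i : ℕ) + 1) (χ i)) (i : Fin n) :
    ∑ σ, value g n (m - choiceCount χ i σ) i = ∑ σ, (value g n (m - choiceCount χ i σ) (i + 1) +
      if IsCandidate σ i then gain g n (m - choiceCount χ i σ) i else 0) := by
  rw [Finset.sum_add_distrib, sum_ite_isCandidate i, Finset.sum_div, ← Finset.sum_add_distrib]
  · exact Finset.sum_congr rfl fun σ _ => value_eq_add_gain g _ i.is_lt
  · intro σ τ h
    have := determinedBefore_choiceCount hχ i σ τ h
    simp only [this]

/-- Total payoff, summed over all orders (not divided by `n !`), of a selection rule. -/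
noncomputable def totalPayoff {n : ℕ} (c : ℝ) (χ : Fin n → Equiv.Perm (Fin n) → Prop) : ℝ :=
  open Classical in ∑ σ, ∑ i, if χ i σ then duration σ i - c else 0

/-- The potential is the value of the unused quota. It telescopes from the full quota at time `0` to
zero at time `n`, so payoffs need only be compared with its decrease at each time. -/
lemma sum_range_potential {n : ℕ} (g : ℕ → ℝ) (m : ℕ)
    (χ : Fin n → Equiv.Perm (Fin n) → Prop) :
    ∑ i : Fin n, (∑ σ, value g n (m - choiceCount χ i σ) i -
      ∑ σ, value g n (m - choiceCount χ (i + 1) σ) (i + 1)) =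
      (n.factorial : ℝ) * value g n m 0 := by
  rw [Fin.sum_univ_eq_sum_range (fun i => (∑ σ, value g n (m - choiceCount χ i σ) i -
      ∑ σ, value g n (m - choiceCount χ (i + 1) σ) (i + 1))), Finset.sum_range_sub']
  simp [choiceCount_zero, value_end, Finset.card_univ, Fintype.card_perm]

lemma totalPayoff_eq {n : ℕ} (c : ℝ) {χ : Fin n → Equiv.Perm (Fin n) → Prop}
    (hχ : ∀ i : Fin n, DeterminedBefore ((i : ℕ) + 1) (χ i)) :
    totalPayoff c χ = open Classical in
      ∑ i, ∑ σ, if χ i σ then expectedDuration n i - c else 0 := by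
  classical
  unfold totalPayoff
  rw [Finset.sum_comm]
  exact Finset.sum_congr rfl fun i _ => sum_ite_duration i c (hχ i)

/-- No selection rule has an expected net payoff above the value. -/
theorem totalPayoff_le {n m : ℕ} (c : ℝ) {χ : Fin n → Equiv.Perm (Fin n) → Prop}
    (hχ : IsSelectionRule m χ) :
    totalPayoff c χ ≤ (n.factorial : ℝ) * value (fun i => expectedDuration n i - c) n m 0 := by
  classical
  rw [totalPayoff_eq c hχ.determined, ← sum_range_potential _ m χ]
  refine Finset.sum_le_sum fun i _ => ?_
  rw [le_sub_iff_add_le, sum_value_eq _ m hχ.determined, ← Finset.sum_add_distrib]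
  refine Finset.sum_le_sum fun σ _ => ?_
  rw [choiceCount_succ]
  -- A choice collects at most the drop in potential plus the gain; declining collects nothing,
  -- while the gain is nonnegative.
  by_cases h : χ i σ
  · have h1 : choiceCount χ i σ + 1 ≤ m := by
      have := choiceCount_mono χ σ (show (i : ℕ) + 1 ≤ n from i.is_lt)
      rw [choiceCount_succ, if_pos h] at this
      exact this.trans (hχ.count_le σ)
    obtain ⟨l, hl⟩ := Nat.exists_eq_add_of_le h1
    have h2 : m - choiceCount χ i σ = l + 1 := by omega
    have h3 : m - (choiceCount χ i σ + 1) = l := by omega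
    simp only [h, hχ.candidate i σ h, if_true, h2, h3, gain]
    have := le_max_right 0 (expectedDuration n i - c +
      value (fun i => expectedDuration n i - c) n l (i + 1) -
      value (fun i => expectedDuration n i - c) n (l + 1) (i + 1))
    linarith
  · simp only [h, if_false, add_zero, zero_add]
    have : 0 ≤ if IsCandidate σ i then
        gain (fun i => expectedDuration n i - c) n (m - choiceCount χ i σ) i else 0 := by
      split_ifs
      · exact gain_nonneg _ _ _ _
      · exact le_rfl
    linarith

/-- The number of choices before time `i` when a candidate is chosen iff this is not worse than
leaving it. -/
noncomputable def greedyCount {n : ℕ} (g : ℕ → ℝ) (m : ℕ) (σ : Equiv.Perm (Fin n)) : ℕ → ℕ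
  | 0 => 0
  | i + 1 => greedyCount g m σ i + (open Classical in
      if (∃ h : i < n, IsCandidate σ ⟨i, h⟩) ∧ greedyCount g m σ i < m ∧
        0 ≤ g i + value g n (m - greedyCount g m σ i - 1) (i + 1) -
          value g n (m - greedyCount g m σ i) (i + 1) then 1 else 0)

/-- Choose a candidate iff this is not worse than leaving it. -/
def greedyRule {n : ℕ} (g : ℕ → ℝ) (m : ℕ) (i : Fin n) (σ : Equiv.Perm (Fin n)) : Prop :=
  IsCandidate σ i ∧ greedyCount g m σ i < m ∧
    0 ≤ g i + value g n (m - greedyCount g m σ i - 1) (i + 1) -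
      value g n (m - greedyCount g m σ i) (i + 1)

/-- The greedy rule depends on its own history; `greedyCount` breaks this circularity by recursion,
and here it is seen to be the true count. -/
lemma choiceCount_greedyRule {n : ℕ} (g : ℕ → ℝ) (m : ℕ) (σ : Equiv.Perm (Fin n)) (i : ℕ)
    (hi : i ≤ n) : choiceCount (greedyRule g m) i σ = greedyCount g m σ i := by
  classical
  induction i with
  | zero => simp [choiceCount_zero, greedyCount]
  | succ i ih =>
    rw [choiceCount_succ _ ⟨i, hi⟩]
    simp only
    rw [ih (by omega), greedyCount]
    congr 1
    have h : i < n := hi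
    simp [greedyRule, h]

lemma greedyCount_le {n : ℕ} (g : ℕ → ℝ) (m : ℕ) (σ : Equiv.Perm (Fin n)) (i : ℕ) :
    greedyCount g m σ i ≤ m := by
  induction i with
  | zero => simp [greedyCount]
  | succ i ih =>
    rw [greedyCount]
    split_ifs with h
    · exact h.2.1
    · exact ih

lemma determinedBefore_greedyCount {n : ℕ} (g : ℕ → ℝ) (m i : ℕ) :
    DeterminedBefore i fun σ : Equiv.Perm (Fin n) => greedyCount g m σ i := by
  induction i with
  | zero => intro σ τ _; simp [greedyCount]
  | succ i ih =>
    intro σ τ h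
    have h1 := ih.mono (Nat.le_succ i) σ τ h
    have h2 : (∃ h : i < n, IsCandidate σ ⟨i, h⟩) ↔ (∃ h : i < n, IsCandidate τ ⟨i, h⟩) :=
      exists_congr fun hi => by
        have := determinedBefore_isCandidate ⟨i, hi⟩ σ τ h
        simpa using this
    simp only at h1
    simp only [greedyCount]
    rw [h1]
    congr 1
    split_ifs with h3 h4 h4
    · rfl
    · exact absurd ⟨h2.1 h3.1, h3.2⟩ h4
    · exact absurd ⟨h2.2 h4.1, h4.2⟩ h3
    · rfl

lemma isSelectionRule_greedyRule {n : ℕ} (g : ℕ → ℝ) (m : ℕ) :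
    IsSelectionRule m (greedyRule (n := n) g m) where
  determined := fun (i : Fin n) σ τ h => by
    have h1 := (determinedBefore_greedyCount g m (i : ℕ)).mono (Nat.le_succ i) σ τ h
    have h2 := determinedBefore_isCandidate i σ τ h
    simp only at h1
    simp only [greedyRule, h1, h2]
  candidate i σ h := h.1
  count_le σ := by
    rw [choiceCount_greedyRule _ _ _ _ le_rfl]
    exact greedyCount_le _ _ _ _

/-- Every inequality in `totalPayoff_le` becomes an equality: a candidate is taken when its
advantage is nonnegative and so equals `gain`, and is left only when `gain` vanishes or the quota is
used up. -/
theorem totalPayoff_greedyRule (n m : ℕ) (c : ℝ) :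
    totalPayoff (n := n) c (greedyRule (fun i => expectedDuration n i - c) m) =
      (n.factorial : ℝ) * value (fun i => expectedDuration n i - c) n m 0 := by
  classical
  set g : ℕ → ℝ := fun i => expectedDuration n i - c with hg
  have hχ := isSelectionRule_greedyRule (n := n) g m
  rw [totalPayoff_eq c hχ.determined, ← sum_range_potential _ m (greedyRule g m)]
  refine Finset.sum_congr rfl fun i _ => ?_
  rw [eq_sub_iff_add_eq, sum_value_eq _ m hχ.determined, ← Finset.sum_add_distrib]
  refine Finset.sum_congr rfl fun σ _ => ?_
  rw [choiceCount_succ, choiceCount_greedyRule _ _ _ _ i.is_lt.le]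
  have hle := greedyCount_le g m σ i
  by_cases h : IsCandidate σ i
  · rcases hle.eq_or_lt with h0 | h1
    · simp [greedyRule, h0, gain]
    · obtain ⟨l, hl⟩ := Nat.exists_eq_add_of_lt h1
      have h2 : m - greedyCount g m σ i = l + 1 := by omega
      have h3 : m - (greedyCount g m σ i + 1) = l := by omega
      by_cases h4 : 0 ≤ g i + value g n l (i + 1) - value g n (l + 1) (i + 1)
      · simp only [greedyRule, h, h1, h2, h3, gain, Nat.add_sub_cancel, h4, and_self, if_true,
          max_eq_right h4]
        simp only [hg]
        ring
      · simp only [greedyRule, h, h2, gain, Nat.add_sub_cancel, h4, and_false, if_true, if_false,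
          max_eq_left (not_le.1 h4).le, add_zero, zero_add]
  · simp [greedyRule, h]

end DurationProblem

/-! ### Stopping vectors versus selection rules -/

namespace DurationProblem

open Finset MeasureTheory

/-- An event belongs to the σ-algebra of the observations up to time `i` iff it depends on the
relative ranks up to time `i` only. -/
lemma measurableSet_rankFiltration_iff {n : ℕ} (i : Fin n) (p : Equiv.Perm (Fin n) → Prop) :
    MeasurableSet[rankFiltration n i] {σ | p σ} ↔ DeterminedBefore ((i : ℕ) + 1) p := by
  constructor
  · rintro ⟨t, -, ht⟩ σ τ h
    have h1 : (fun j : {j : Fin n // j ≤ i} => relRank σ j.1) = fun j => relRank τ j.1 :=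
      funext fun j => h j.1 (Nat.lt_succ_of_le j.2)
    have h2 : ∀ σ, p σ ↔ (fun j : {j : Fin n // j ≤ i} => relRank σ j.1) ∈ t := by
      intro σ
      rw [← Set.mem_preimage (f := fun σ (j : {j : Fin n // j ≤ i}) => relRank σ j.1), ht]
      rfl
    rw [eq_iff_iff, h2, h2, h1]
  · intro h
    refine ⟨{r | ∃ σ, p σ ∧ (fun j : {j : Fin n // j ≤ i} => relRank σ j.1) = r},
      MeasurableSpace.measurableSet_top, ?_⟩
    ext σ
    simp only [Set.mem_preimage, Set.mem_ofPred_eq]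
    constructor
    · rintro ⟨τ, hτ, h1⟩
      rw [← h τ σ fun j hj => congrFun h1 ⟨j, Nat.le_of_lt_succ hj⟩]
      exact hτ
    · exact fun h1 => ⟨σ, h1, rfl⟩

/-- The selection rule of a stopping vector. -/
def ruleOfTimes {n m : ℕ} (τ : Fin m → Equiv.Perm (Fin n) → WithTop (Fin n)) (i : Fin n)
    (σ : Equiv.Perm (Fin n)) : Prop :=
  ∃ k, τ k σ = (i : WithTop (Fin n))

lemma isSelectionRule_ruleOfTimes {n m : ℕ} {τ : Fin m → Equiv.Perm (Fin n) → WithTop (Fin n)}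
    (hτ : IsStoppingVector τ) : IsSelectionRule m (ruleOfTimes τ) where
  determined := fun i σ σ' h => by
    have hle : ∀ k, ∀ j ≤ i, (τ k σ ≤ (j : WithTop (Fin n)) ↔ τ k σ' ≤ (j : WithTop (Fin n))) := by
      intro k j hj
      have := (measurableSet_rankFiltration_iff j fun σ => τ k σ ≤ (j : WithTop (Fin n))).1
        (hτ.isStoppingTime k j)
      rw [Fin.le_def] at hj
      exact iff_of_eq (this σ σ' fun l hl => h l (by omega))
    -- Stopping times control only the events `τ k ≤ j`; the event `τ k = i` is recovered from those
    -- with `j ≤ i`.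
    have heq : ∀ σ k, τ k σ = (i : WithTop (Fin n)) ↔
        τ k σ ≤ (i : WithTop (Fin n)) ∧ ∀ j < i, ¬ τ k σ ≤ (j : WithTop (Fin n)) := by
      intro σ k
      constructor
      · intro h1
        rw [h1]
        exact ⟨le_rfl, fun j hj => by simpa using hj⟩
      · rintro ⟨h1, h2⟩
        obtain ⟨l, hl, hli⟩ := WithTop.le_coe_iff.1 h1
        rcases hli.eq_or_lt with h3 | h3
        · rw [hl, h3]
        · exact absurd hl.le (h2 l h3)
    rw [eq_iff_iff]
    refine exists_congr fun k => ?_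
    rw [heq, heq, hle k i le_rfl]
    refine and_congr_right fun _ => forall_congr' fun j => forall_congr' fun hj => ?_
    rw [hle k j hj.le]
  candidate := fun i σ ⟨k, hk⟩ => hτ.candidate k σ i hk
  count_le := fun σ => by
    classical
    unfold choiceCount
    calc _ = ((univ.filter fun j : Fin n => (j : ℕ) < n ∧ ruleOfTimes τ j σ).image
              (WithTop.some : Fin n → WithTop (Fin n))).card :=
            (Finset.card_image_of_injective _ WithTop.coe_injective).symm
      _ ≤ (univ.image fun k : Fin m => τ k σ).card := by
            refine Finset.card_le_card fun x hx => ?_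
            simp only [mem_image, mem_filter, mem_univ, true_and] at hx ⊢
            obtain ⟨j, ⟨-, k, hk⟩, rfl⟩ := hx
            exact ⟨k, hk⟩
      _ ≤ m := Finset.card_image_le.trans (by simp)

/-- Strict increase of the times ensures that a chosen object comes from exactly one index `k`, so
no payoff is counted twice. -/
lemma sum_choicePayoff_eq {n m : ℕ} (c : ℝ) {τ : Fin m → Equiv.Perm (Fin n) → WithTop (Fin n)}
    {χ : Fin n → Equiv.Perm (Fin n) → Prop} (σ : Equiv.Perm (Fin n))
    (hinc : ∀ k l, k < l → τ l σ ≠ ⊤ → τ k σ < τ l σ)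
    (hχ : ∀ i, χ i σ ↔ ∃ k, τ k σ = (i : WithTop (Fin n))) :
    ∑ k, choicePayoff c σ (τ k σ) =
      open Classical in ∑ i, if χ i σ then duration σ i - c else 0 := by
  classical
  have h1 : ∀ k, choicePayoff c σ (τ k σ) =
      ∑ i : Fin n, if τ k σ = (i : WithTop (Fin n)) then duration σ i - c else 0 := by
    intro k
    cases τ k σ with
    | top => simp [choicePayoff]
    | coe j => simp [choicePayoff, WithTop.coe_inj]
  rw [Finset.sum_congr rfl fun k _ => h1 k, Finset.sum_comm]
  refine Finset.sum_congr rfl fun i _ => ?_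
  by_cases h : χ i σ
  · obtain ⟨k, hk⟩ := (hχ i).1 h
    rw [if_pos h, Finset.sum_eq_single_of_mem k (mem_univ k), if_pos hk]
    intro l _ hl
    rw [if_neg]
    intro hl'
    rcases lt_or_gt_of_ne hl with h2 | h2
    · have := hinc l k h2 (by simp [hk])
      rw [hk, hl'] at this
      exact lt_irrefl _ this
    · have := hinc k l h2 (by simp [hl'])
      rw [hk, hl'] at this
      exact lt_irrefl _ this
  · rw [if_neg h]
    refine Finset.sum_eq_zero fun k _ => if_neg fun hk => h ((hχ i).2 ⟨k, hk⟩)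

lemma expectedNetPayoff_eq {n m : ℕ} (c : ℝ)
    {τ : Fin m → Equiv.Perm (Fin n) → WithTop (Fin n)}
    {χ : Fin n → Equiv.Perm (Fin n) → Prop}
    (hinc : ∀ k l, k < l → ∀ σ, τ l σ ≠ ⊤ → τ k σ < τ l σ)
    (hχ : ∀ i σ, χ i σ ↔ ∃ k, τ k σ = (i : WithTop (Fin n))) :
    expectedNetPayoff c τ = totalPayoff c χ / (n.factorial : ℝ) := by
  unfold expectedNetPayoff totalPayoff
  congr 1
  exact Finset.sum_congr rfl fun σ _ =>
    sum_choicePayoff_eq c σ (fun k l h => hinc k l h σ) fun i => hχ i σ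

/-- The stopping vector of a selection rule: the choice number `k + 1` is made when an object is
chosen after exactly `k` earlier choices. -/
noncomputable def timesOfRule {n m : ℕ} (χ : Fin n → Equiv.Perm (Fin n) → Prop) (k : Fin m)
    (σ : Equiv.Perm (Fin n)) : WithTop (Fin n) :=
  open Classical in (univ.filter fun i : Fin n => χ i σ ∧ choiceCount χ i σ = k).min

/-- Each choice raises the count strictly. Hence the set in `timesOfRule` has at most one element,
and `min` merely extracts it or returns `⊤`. -/
lemma choice_unique {n : ℕ} {χ : Fin n → Equiv.Perm (Fin n) → Prop} {σ : Equiv.Perm (Fin n)}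
    {i j : Fin n} (hi : χ i σ) (hj : χ j σ) (hij : choiceCount χ i σ = choiceCount χ j σ) :
    i = j := by
  classical
  have key : ∀ i j : Fin n, χ i σ → i < j → choiceCount χ i σ < choiceCount χ j σ := by
    intro i j hi hij
    have h1 := choiceCount_succ χ i σ
    rw [if_pos hi] at h1
    have := choiceCount_mono χ σ (show (i : ℕ) + 1 ≤ j from hij)
    omega
  rcases lt_trichotomy i j with h | h | h
  · exact absurd hij (key i j hi h).ne
  · exact h
  · exact absurd hij (key j i hj h).ne'

lemma timesOfRule_eq_coe_iff {n m : ℕ} {χ : Fin n → Equiv.Perm (Fin n) → Prop} {k : Fin m}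
    {σ : Equiv.Perm (Fin n)} {i : Fin n} :
    timesOfRule χ k σ = (i : WithTop (Fin n)) ↔ χ i σ ∧ choiceCount χ i σ = k := by
  classical
  unfold timesOfRule
  constructor
  · intro h
    simpa using Finset.mem_of_min h
  · intro h
    have h1 : (univ.filter fun i : Fin n => χ i σ ∧ choiceCount χ i σ = k) = {i} := by
      ext j
      simp only [mem_filter, mem_univ, true_and, mem_singleton]
      constructor
      · rintro ⟨h2, h3⟩
        exact choice_unique h2 h.1 (h3.trans h.2.symm)
      · rintro rfl
        exact h
    rw [h1, Finset.min_singleton]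

/-- A discrete intermediate value argument: the count starts at `0` and rises by at most one at a
time. -/
lemma exists_choice_of_lt_choiceCount {n : ℕ} (χ : Fin n → Equiv.Perm (Fin n) → Prop)
    (σ : Equiv.Perm (Fin n)) (k i : ℕ) (hi : i ≤ n) (h : k < choiceCount χ i σ) :
    ∃ j : Fin n, (j : ℕ) < i ∧ χ j σ ∧ choiceCount χ j σ = k := by
  classical
  induction i with
  | zero => simp [choiceCount_zero] at h
  | succ i ih =>
    by_cases h1 : k < choiceCount χ i σ
    · obtain ⟨j, h2, h3⟩ := ih (by omega) h1
      exact ⟨j, by omega, h3⟩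
    · have h2 := choiceCount_succ χ ⟨i, hi⟩ σ
      simp only at h2
      split_ifs at h2 with h3
      · exact ⟨⟨i, hi⟩, by simp, h3, by simp only; omega⟩
      · omega

lemma timesOfRule_increasing {n m : ℕ} (χ : Fin n → Equiv.Perm (Fin n) → Prop) (k l : Fin m)
    (hkl : k < l) (σ : Equiv.Perm (Fin n)) (h : timesOfRule χ l σ ≠ ⊤) :
    timesOfRule χ k σ < timesOfRule χ l σ := by
  obtain ⟨j, hj⟩ := WithTop.ne_top_iff_exists.1 h
  have h1 := timesOfRule_eq_coe_iff.1 hj.symm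
  obtain ⟨i, h2, h3, h4⟩ := exists_choice_of_lt_choiceCount χ σ k j j.is_lt.le
    (by rw [h1.2]; exact hkl)
  rw [← hj, timesOfRule_eq_coe_iff.2 ⟨h3, h4⟩]
  exact WithTop.coe_lt_coe.2 h2

lemma isStoppingVector_timesOfRule {n m : ℕ} {χ : Fin n → Equiv.Perm (Fin n) → Prop}
    (hχ : IsSelectionRule m χ) : IsStoppingVector (timesOfRule (m := m) χ) where
  isStoppingTime k i := by
    rw [measurableSet_rankFiltration_iff i]
    have h1 : ∀ σ, timesOfRule χ k σ ≤ (i : WithTop (Fin n)) ↔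
        ∃ j ≤ i, χ j σ ∧ choiceCount χ j σ = k := by
      intro σ
      rw [WithTop.le_coe_iff]
      constructor
      · rintro ⟨j, h1, h2⟩
        exact ⟨j, h2, timesOfRule_eq_coe_iff.1 h1⟩
      · rintro ⟨j, h1, h2⟩
        exact ⟨j, timesOfRule_eq_coe_iff.2 h2, h1⟩
    intro σ τ h
    rw [eq_iff_iff]
    refine (h1 σ).trans (Iff.trans ?_ (h1 τ).symm)
    refine exists_congr fun j => and_congr_right fun hj => ?_
    rw [Fin.le_def] at hj
    rw [hχ.determined j σ τ fun l hl => h l (by omega),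
      determinedBefore_choiceCount hχ.determined j σ τ fun l hl => h l (by omega)]
  increasing := timesOfRule_increasing χ
  candidate k σ i h := hχ.candidate i σ (timesOfRule_eq_coe_iff.1 h).1

lemma rule_iff_exists_timesOfRule {n m : ℕ} {χ : Fin n → Equiv.Perm (Fin n) → Prop}
    (hχ : IsSelectionRule m χ) (i : Fin n) (σ : Equiv.Perm (Fin n)) :
    χ i σ ↔ ∃ k : Fin m, timesOfRule χ k σ = (i : WithTop (Fin n)) := by
  classical
  simp only [timesOfRule_eq_coe_iff]
  constructor
  · intro h
    have h1 := choiceCount_succ χ i σ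
    rw [if_pos h] at h1
    have h2 := choiceCount_mono χ σ (show (i : ℕ) + 1 ≤ n from i.is_lt)
    have h3 := hχ.count_le σ
    exact ⟨⟨choiceCount χ i σ, by omega⟩, h, rfl⟩
  · rintro ⟨k, h, -⟩
    exact h

/-- The optimal expected net payoff solves the dynamic programming recursion. -/
theorem optimalNetPayoff_eq_value (n m : ℕ) (c : ℝ) :
    optimalNetPayoff n m c = value (fun i => expectedDuration n i - c) n m 0 := by
  have hn : (0 : ℝ) < n.factorial := by exact_mod_cast n.factorial_pos
  refine IsGreatest.csSup_eq ⟨?_, ?_⟩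
  · have h := isSelectionRule_greedyRule (n := n) (fun i => expectedDuration n i - c) m
    refine ⟨_, isStoppingVector_timesOfRule h, ?_⟩
    rw [expectedNetPayoff_eq c (timesOfRule_increasing _) (rule_iff_exists_timesOfRule h),
      totalPayoff_greedyRule]
    field_simp
  · rintro v ⟨τ, hτ, rfl⟩
    rw [expectedNetPayoff_eq c hτ.increasing (χ := ruleOfTimes τ) fun _ _ => Iff.rfl,
      div_le_iff₀ hn, mul_comm]
    exact totalPayoff_le c (isSelectionRule_ruleOfTimes hτ)

end DurationProblem

/-! ### Monotonicity, the unlimited problem and the factorial deficit bound -/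

namespace DurationProblem

open Finset

/-- A step of the dynamic programming recursion is monotone. -/
lemma add_max_div_mono {k g a a' b b' : ℝ} (hk : 1 ≤ k) (ha : a ≤ a') (hb : b ≤ b') :
    a + max 0 (g + b - a) / k ≤ a' + max 0 (g + b' - a') / k := by
  -- Raising `a` to `a'` lowers the maximum by at most `a' - a`, and dividing by `k ≥ 1` keeps this
  -- loss within the direct increase.
  have h1 : max 0 (g + b - a) ≤ max 0 (g + b' - a') + (a' - a) := by
    apply max_le
    · have := le_max_left 0 (g + b' - a')
      linarith
    · have := le_max_right 0 (g + b' - a')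
      linarith
  have h2 : max 0 (g + b - a) / k ≤ (max 0 (g + b' - a') + (a' - a)) / k := by gcongr
  have h3 : (a' - a) / k ≤ a' - a := div_le_self (by linarith) hk
  rw [add_div] at h2
  linarith

/-- A step of the dynamic programming recursion is nonexpansive. -/
lemma abs_add_max_div_sub_le {k θ a a' h h' : ℝ} (hk : 1 ≤ k) (hθ₀ : 0 ≤ θ) (hθ₁ : θ ≤ 1) :
    |(a + max 0 (h - θ * a) / k) - (a' + max 0 (h' - θ * a') / k)| ≤
      |a - a'| + |h - h'| / k := by
  have key : ∀ a a' h h' : ℝ, (a + max 0 (h - θ * a) / k) - (a' + max 0 (h' - θ * a') / k) ≤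
      |a - a'| + |h - h'| / k := by
    intro a a' h h'
    have hk0 : 0 < k := by linarith
    have h1 := le_max_left 0 (h' - θ * a')
    have h2 := le_max_right 0 (h' - θ * a')
    have h3 := le_abs_self (a - a')
    have h4 := neg_abs_le (a - a')
    have h5 := le_abs_self (h - h')
    have h6 := abs_nonneg (h - h')
    have h7 : max 0 (h - θ * a) / k ≤
        (max 0 (h' - θ * a') + |h - h'| + (|a - a'| - (a - a'))) / k := by
      gcongr
      apply max_le
      · linarith
      · nlinarith [abs_nonneg (a - a')]
    have h8 : (|a - a'| - (a - a')) / k ≤ |a - a'| - (a - a') := div_le_self (by linarith) hk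
    rw [add_div, add_div] at h7
    linarith
  rw [abs_le]
  refine ⟨?_, key a a' h h'⟩
  have := key a' a h' h
  rw [abs_sub_comm a' a, abs_sub_comm h' h] at this
  linarith

lemma value_mono (g : ℕ → ℝ) {n i : ℕ} (l : ℕ) (hi : i ≤ n) :
    value g n l i ≤ value g n (l + 1) i := by
  induction l generalizing i with
  | zero =>
    induction hi using Nat.decreasingInduction with
    | self => simp [value_end]
    | of_succ i hi ih =>
      rw [value_zero] at ih ⊢
      rw [value_succ g 0 hi]
      have := le_max_left 0 (g i + value g n 0 (i + 1) - value g n (0 + 1) (i + 1))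
      positivity
  | succ l ihl =>
    induction hi using Nat.decreasingInduction with
    | self => simp [value_end]
    | of_succ i hi ih =>
      rw [value_succ g l hi, value_succ g (l + 1) hi]
      have : (0 : ℝ) ≤ i := i.cast_nonneg
      exact add_max_div_mono (by linarith) ih (ihl hi)

/-- The value does not depend on the starting time as long as choices do not pay. -/
lemma value_eq_of_nonpos (g : ℕ → ℝ) {n j : ℕ} (l : ℕ) (hj : j ≤ n) (hg : ∀ i < j, g i ≤ 0) :
    value g n l 0 = value g n l j := by
  induction j with
  | zero => rfl
  | succ j ih =>
    rw [ih (by omega) fun i hi => hg i (by omega)]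
    cases l with
    | zero => simp [value_zero]
    | succ l =>
      have h1 := value_mono g l hj
      have h2 := hg j (Nat.lt_succ_self j)
      rw [value_succ g l hj, max_eq_left (by linarith)]
      simp

/-- The optimal expected net payoff from time `i` on if the number of choices is unlimited. -/
noncomputable def unlimitedValue (g : ℕ → ℝ) (n i : ℕ) : ℝ :=
  ∑ t ∈ Ico i n, max 0 (g t) / ((t : ℝ) + 1)

lemma unlimitedValue_end (g : ℕ → ℝ) (n : ℕ) : unlimitedValue g n n = 0 := by
  simp [unlimitedValue]

lemma unlimitedValue_step (g : ℕ → ℝ) {n i : ℕ} (hi : i < n) :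
    unlimitedValue g n i = unlimitedValue g n (i + 1) + max 0 (g i) / ((i : ℝ) + 1) := by
  rw [unlimitedValue, Finset.sum_eq_sum_Ico_succ_bot hi, add_comm, unlimitedValue]

lemma unlimitedValue_antitone (g : ℕ → ℝ) {n i j : ℕ} (hij : i ≤ j) :
    unlimitedValue g n j ≤ unlimitedValue g n i := by
  refine Finset.sum_le_sum_of_subset_of_nonneg (Finset.Ico_subset_Ico_left hij) fun t _ _ => ?_
  have := le_max_left 0 (g t)
  positivity

lemma unlimitedValue_nonneg (g : ℕ → ℝ) (n i : ℕ) : 0 ≤ unlimitedValue g n i := by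
  refine Finset.sum_nonneg fun t _ => ?_
  have := le_max_left 0 (g t)
  positivity

/-- By `value_mono`, using up a choice can only lower the continuation value, so the advantage of
choosing never exceeds `g`. -/
lemma value_le_unlimitedValue (g : ℕ → ℝ) {n i : ℕ} (l : ℕ) (hi : i ≤ n) :
    value g n l i ≤ unlimitedValue g n i := by
  cases l with
  | zero => rw [value_zero]; exact unlimitedValue_nonneg g n i
  | succ l =>
    induction hi using Nat.decreasingInduction with
    | self => simp [value_end, unlimitedValue_end]
    | of_succ i hi ih =>
      rw [value_succ g l hi, unlimitedValue_step g hi]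
      have h1 := value_mono g l (show i + 1 ≤ n from hi)
      gcongr
      linarith

/-- A partial sum of the harmonic series. -/
noncomputable def harmonicTail (n i : ℕ) : ℝ := ∑ t ∈ Ico i n, 1 / ((t : ℝ) + 1)

lemma harmonicTail_step {n i : ℕ} (hi : i < n) :
    harmonicTail n i = harmonicTail n (i + 1) + 1 / ((i : ℝ) + 1) := by
  rw [harmonicTail, Finset.sum_eq_sum_Ico_succ_bot hi, add_comm, harmonicTail]

lemma harmonicTail_nonneg (n i : ℕ) : 0 ≤ harmonicTail n i :=
  Finset.sum_nonneg fun t _ => by positivity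

lemma expectedDuration_eq (n i : ℕ) :
    expectedDuration n i = ((i : ℝ) + 1) * harmonicTail n i := by
  rw [expectedDuration, harmonicTail, Finset.mul_sum]
  exact Finset.sum_congr rfl fun t _ => by ring

/-- Backward induction from `1 / (i + 2) ≤ log ((i + 2) / (i + 1)) ≤ 1 / (i + 1)`. -/
lemma harmonicTail_bounds {n i : ℕ} (hi : i < n) :
    Real.log (n / ((i : ℝ) + 1)) ≤ harmonicTail n i ∧
      harmonicTail n i ≤ Real.log (n / ((i : ℝ) + 1)) + 1 / ((i : ℝ) + 1) := by
  obtain ⟨n, rfl⟩ : ∃ k, n = k + 1 := ⟨n - 1, by omega⟩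
  have hi' : i ≤ n := by omega
  clear hi
  have hn : ((n + 1 : ℕ) : ℝ) ≠ 0 := by positivity
  induction hi' using Nat.decreasingInduction with
  | self =>
    have : harmonicTail (n + 1) n = 1 / ((n : ℝ) + 1) := by simp [harmonicTail]
    rw [this]
    push_cast
    rw [div_self (by positivity), Real.log_one]
    constructor
    · positivity
    · simp
  | of_succ i hi ih =>
    rw [harmonicTail_step (by omega : i < n + 1)]
    have hk : (0 : ℝ) < (i : ℝ) + 1 := by positivity
    have hk' : (0 : ℝ) < (i : ℝ) + 1 + 1 := by positivity
    push_cast at ih hn ⊢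
    rw [Real.log_div hn (by positivity)] at ih ⊢
    have h1 := Real.one_sub_inv_le_log_of_pos (div_pos hk' hk)
    have h2 := Real.log_le_sub_one_of_pos (div_pos hk' hk)
    rw [Real.log_div hk'.ne' hk.ne'] at h1 h2
    have h3 : 1 - (((i : ℝ) + 1 + 1) / ((i : ℝ) + 1))⁻¹ = 1 / ((i : ℝ) + 1 + 1) := by
      field_simp
      ring
    have h4 : ((i : ℝ) + 1 + 1) / ((i : ℝ) + 1) - 1 = 1 / ((i : ℝ) + 1) := by
      field_simp
      ring
    constructor <;> linarith [ih.1, ih.2]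

lemma expectedDuration_div_bounds {n i : ℕ} (hi : i < n) :
    Real.negMulLog (((i : ℝ) + 1) / n) ≤ expectedDuration n i / n ∧
      expectedDuration n i / n ≤ Real.negMulLog (((i : ℝ) + 1) / n) + 1 / n := by
  have hn : (0 : ℝ) < n := by exact_mod_cast (by omega : 0 < n)
  have hk : (0 : ℝ) < (i : ℝ) + 1 := by positivity
  obtain ⟨h1, h2⟩ := harmonicTail_bounds hi
  have h3 : Real.negMulLog (((i : ℝ) + 1) / n) =
      ((i : ℝ) + 1) * Real.log (n / ((i : ℝ) + 1)) / n := by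
    rw [Real.negMulLog, Real.log_div hk.ne' hn.ne', Real.log_div hn.ne' hk.ne']
    ring
  rw [h3, expectedDuration_eq, ← add_div]
  constructor
  · gcongr
  · gcongr
    calc _ ≤ ((i : ℝ) + 1) * (Real.log (n / ((i : ℝ) + 1)) + 1 / ((i : ℝ) + 1)) := by gcongr
      _ = _ := by field_simp

/-- The loss caused by the restriction to `l` choices decays factorially in `l`. -/
lemma unlimitedValue_sub_value_le (g : ℕ → ℝ) {n i j : ℕ} (l : ℕ) (hji : j ≤ i) (hi : i ≤ n) :
    unlimitedValue g n i - value g n l i ≤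
      unlimitedValue g n j * (harmonicTail n i ^ l / (l.factorial : ℝ)) := by
  induction l generalizing i with
  | zero => simpa [value_zero] using unlimitedValue_antitone g hji
  | succ l ihl =>
    have hM := unlimitedValue_nonneg g n j
    revert hji
    induction hi using Nat.decreasingInduction with
    | self =>
      intro _
      rw [unlimitedValue_end, value_end, sub_zero]
      have := harmonicTail_nonneg n n
      positivity
    | of_succ i hi ih =>
      intro hji
      have ih := ih (by omega)
      have ihl := ihl (i := i + 1) (by omega) hi
      have hD := value_le_unlimitedValue g (l + 1) (show i + 1 ≤ n from hi)
      have hDl := value_le_unlimitedValue g l (show i + 1 ≤ n from hi)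
      rw [value_succ g l hi, unlimitedValue_step g hi]
      set A := unlimitedValue g n (i + 1)
      set M := unlimitedValue g n j
      set S := harmonicTail n (i + 1) with hS
      have hS0 : 0 ≤ S := harmonicTail_nonneg _ _
      have hk : (0 : ℝ) < (i : ℝ) + 1 := by positivity
      -- The new loss at level `l + 1` is at most the deficit at level `l`, weighted by `1 / (i +
      -- 1)`. Iterating this mimics repeated integration of a constant, whence `S ^ l / l!`.
      have h1 : max 0 (g i) - max 0 (g i + value g n l (i + 1) - value g n (l + 1) (i + 1)) ≤
          A - value g n l (i + 1) := by
        rw [sub_le_iff_le_add]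
        have h3 := le_max_left 0 (g i + value g n l (i + 1) - value g n (l + 1) (i + 1))
        have h4 := le_max_right 0 (g i + value g n l (i + 1) - value g n (l + 1) (i + 1))
        apply max_le <;> linarith
      have h2 : (max 0 (g i) - max 0 (g i + value g n l (i + 1) - value g n (l + 1) (i + 1))) /
          ((i : ℝ) + 1) ≤ M * (S ^ l / (l.factorial : ℝ)) / ((i : ℝ) + 1) := by
        gcongr
        exact h1.trans ihl
      rw [sub_div] at h2
      -- Bernoulli's inequality: the first two binomial terms of the power of `S + 1 / (i + 1)`.
      have h5 : S ^ (l + 1) + (l + 1 : ℕ) * S ^ l * (1 / ((i : ℝ) + 1)) ≤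
          harmonicTail n i ^ (l + 1) := by
        rw [harmonicTail_step hi, ← hS]
        have h6 : (0 : ℝ) ≤ 1 / ((i : ℝ) + 1) := by positivity
        have h7 := pow_add_mul_le_add_pow hS0
          (by linarith : 0 ≤ 2 * S + 1 / ((i : ℝ) + 1)) (l + 1)
        rw [Nat.add_sub_cancel] at h7
        linarith
      have h8 : M * (S ^ (l + 1) / ((l + 1).factorial : ℝ)) +
          M * (S ^ l / (l.factorial : ℝ)) / ((i : ℝ) + 1) ≤
          M * (harmonicTail n i ^ (l + 1) / ((l + 1).factorial : ℝ)) := by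
        have h9 : M * (S ^ (l + 1) / ((l + 1).factorial : ℝ)) +
          M * (S ^ l / (l.factorial : ℝ)) / ((i : ℝ) + 1) = 
          M * ((S ^ (l + 1) + (l + 1 : ℕ) * S ^ l * (1 / ((i : ℝ) + 1))) /
            ((l + 1).factorial : ℝ)) := by
          have : (l.factorial : ℝ) ≠ 0 := by positivity
          rw [Nat.factorial_succ]
          push_cast
          field_simp
        rw [h9]
        gcongr
      linarith

end DurationProblem

/-! ### Euler scheme and the limiting differential equation -/

namespace DurationProblem

open Filter Set Topology

/-- The grid functions `i ↦ a n i` converge to `v` uniformly on the grid points `i / n` in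
`[δ, 1]`. -/
def GridConverges (δ : ℝ) (a : ℕ → ℕ → ℝ) (v : ℝ → ℝ) : Prop :=
  ∀ ε > 0, ∀ᶠ n : ℕ in atTop, ∀ i ≤ n, δ * n ≤ i → |a n i - v ((i : ℝ) / n)| ≤ ε

lemma gridConverges_zero (δ : ℝ) : GridConverges δ (fun _ _ => 0) fun _ => 0 := by
  intro ε hε
  refine Eventually.of_forall fun n i _ _ => ?_
  simpa using hε.le

lemma GridConverges.add {δ : ℝ} {a b : ℕ → ℕ → ℝ} {v w : ℝ → ℝ} (ha : GridConverges δ a v)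
    (hb : GridConverges δ b w) :
    GridConverges δ (fun n i => a n i + b n i) fun x => v x + w x := by
  intro ε hε
  filter_upwards [ha (ε / 2) (half_pos hε), hb (ε / 2) (half_pos hε)] with n h1 h2 i hi hδ
  have h3 := abs_add_le (a n i - v ((i : ℝ) / n)) (b n i - w ((i : ℝ) / n))
  have h4 := h1 i hi hδ
  have h5 := h2 i hi hδ
  rw [add_sub_add_comm]
  linarith

lemma div_mem_Icc {δ : ℝ} {i n : ℕ} (hn : 0 < n) (hi : i ≤ n) (hδ : δ * n ≤ i) :
    (i : ℝ) / n ∈ Icc δ 1 := by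
  have hn' : (0 : ℝ) < n := by exact_mod_cast hn
  have hi' : (i : ℝ) ≤ n := by exact_mod_cast hi
  exact ⟨(le_div_iff₀ hn').2 hδ, (div_le_one hn').2 hi'⟩

/-- The grid points `⌈δ n⌉ / n` tend to `δ` from inside `[δ, 1]`, so continuity within the interval
is enough. -/
lemma GridConverges.tendsto {δ : ℝ} {a : ℕ → ℕ → ℝ} {v : ℝ → ℝ} (ha : GridConverges δ a v)
    (hδ₀ : 0 ≤ δ) (hδ₁ : δ ≤ 1) (hv : ContinuousOn v (Icc δ 1)) :
    Tendsto (fun n : ℕ => a n ⌈δ * n⌉₊) atTop (𝓝 (v δ)) := by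
  have h1 : Tendsto (fun n : ℕ => a n ⌈δ * n⌉₊ - v ((⌈δ * n⌉₊ : ℝ) / n)) atTop (𝓝 0) := by
    rw [Metric.tendsto_atTop']
    intro ε hε
    obtain ⟨N, hN⟩ := eventually_atTop.1 (ha (ε / 2) (half_pos hε))
    refine ⟨N, fun n hn => ?_⟩
    have hceil : ⌈δ * n⌉₊ ≤ n := by
      rw [Nat.ceil_le]
      have : (0 : ℝ) ≤ n := n.cast_nonneg
      nlinarith
    have := hN n hn.le _ hceil (Nat.le_ceil _)
    rw [Real.dist_eq, sub_zero]
    linarith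
  have h2 : Tendsto (fun n : ℕ => (⌈δ * n⌉₊ : ℝ) / n) atTop (𝓝[Icc δ 1] δ) := by
    rw [tendsto_nhdsWithin_iff]
    constructor
    · exact (tendsto_nat_ceil_mul_div_atTop hδ₀).comp tendsto_natCast_atTop_atTop
    · filter_upwards [eventually_gt_atTop 0] with n hn
      refine div_mem_Icc hn ?_ (Nat.le_ceil _)
      rw [Nat.ceil_le]
      have : (0 : ℝ) ≤ n := n.cast_nonneg
      nlinarith
  have h3 := (hv δ (left_mem_Icc.2 hδ₁)).tendsto.comp h2
  simpa using h1.add h3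

/-- A solution on an interval of a differential equation whose right-hand side is continuous
varies almost linearly over short distances. -/
lemma abs_sub_sub_mul_le {δ ε η : ℝ} {v f : ℝ → ℝ}
    (hv : ∀ x ∈ Icc δ 1, HasDerivWithinAt v (-f x) (Icc δ 1) x)
    (hη : ∀ x ∈ Icc δ 1, ∀ y ∈ Icc δ 1, dist x y < η → |f x - f y| ≤ ε)
    {x y : ℝ} (hx : x ∈ Icc δ 1) (hy : y ∈ Icc δ 1) (hxy : x ≤ y) (hd : y - x < η) :
    |v x - (v y + f y * (y - x))| ≤ ε * (y - x) := by
  have hsub : Icc x y ⊆ Icc δ 1 := Icc_subset_Icc hx.1 hy.2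
  -- Removing the tangent slope at `y` leaves a derivative of size at most `ε`, ready for the mean
  -- value inequality.
  have h1 : ∀ t ∈ Icc x y, HasDerivWithinAt (fun t => v t + f y * t) (-f t + f y) (Icc x y) t := by
    intro t ht
    have : HasDerivWithinAt (fun t => f y * t) (f y) (Icc x y) t := by
      simpa using (hasDerivWithinAt_id t (Icc x y)).const_mul (f y)
    exact ((hv t (hsub ht)).mono hsub).add this
  have h2 := (convex_Icc x y).norm_image_sub_le_of_norm_hasDerivWithin_le (C := ε) h1
    (fun t ht => by
      have := hη t (hsub ht) y hy (by
        rw [Real.dist_eq, abs_of_nonpos (by linarith [ht.2])]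
        linarith [ht.1])
      rw [Real.norm_eq_abs, neg_add_eq_sub, abs_sub_comm]
      exact this) (right_mem_Icc.2 hxy) (left_mem_Icc.2 hxy)
  rw [Real.norm_eq_abs, Real.norm_eq_abs, abs_sub_comm x y, abs_of_nonneg (sub_nonneg.2 hxy)] at h2
  convert h2 using 2
  ring

/-- Convergence of the backward Euler scheme for the differential equation
`v' x = - max 0 (H x - θ * v x) / x` with the end condition `v 1 = 0`. -/
theorem gridConverges_of_recursion {δ θ : ℝ} (hδ₀ : 0 < δ) (hθ₀ : 0 ≤ θ)
    (hθ₁ : θ ≤ 1) {a h : ℕ → ℕ → ℝ} {v H : ℝ → ℝ} (hH : ContinuousOn H (Icc δ 1))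
    (hv : ∀ x ∈ Icc δ 1, HasDerivWithinAt v (-(max 0 (H x - θ * v x) / x)) (Icc δ 1) x)
    (hv₁ : v 1 = 0) (hh : GridConverges δ h H) (ha₁ : ∀ n, a n n = 0)
    (ha : ∀ n i, i < n → a n i = a n (i + 1) +
      max 0 (h n (i + 1) - θ * a n (i + 1)) / ((i : ℝ) + 1)) :
    GridConverges δ a v := by
  intro ε hε
  have hvc : ContinuousOn v (Icc δ 1) := fun x hx => (hv x hx).continuousWithinAt
  have hf : ContinuousOn (fun x => max 0 (H x - θ * v x) / x) (Icc δ 1) := by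
    refine ContinuousOn.div ?_ continuousOn_id fun x hx => (hδ₀.trans_le hx.1).ne'
    exact ContinuousOn.sup continuousOn_const (hH.sub (continuousOn_const.mul hvc))
  have huc := isCompact_Icc.uniformContinuousOn_of_continuous hf
  -- Per step, the scheme's local error is at most `ε' / n` and the data error at most `ε' / (δ n)`;
  -- this choice makes their sum `ε / n`.
  set ε' := ε / (1 + 1 / δ) with hε'
  have hε'0 : 0 < ε' := by positivity
  obtain ⟨η, hη0, hη⟩ := Metric.uniformContinuousOn_iff.1 huc ε' hε'0
  have hη' : ∀ x ∈ Icc δ 1, ∀ y ∈ Icc δ 1, dist x y < η →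
      |max 0 (H x - θ * v x) / x - max 0 (H y - θ * v y) / y| ≤ ε' :=
    fun x hx y hy hxy => (hη x hx y hy hxy).le
  have hlarge : ∀ᶠ n : ℕ in atTop, 1 / (n : ℝ) < η :=
    (tendsto_one_div_atTop_nhds_zero_nat (𝕜 := ℝ)).eventually_lt_const hη0
  filter_upwards [hh ε' hε'0, hlarge, eventually_gt_atTop 0] with n hn hnη hn0
  have hnR : (0 : ℝ) < n := by exact_mod_cast hn0
  -- Errors only add up along the backward induction, without amplification, because a step is
  -- nonexpansive.
  have main : ∀ i ≤ n, δ * n ≤ i → |a n i - v ((i : ℝ) / n)| ≤ (n - i : ℝ) * (ε / n) := by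
    intro i hi
    induction hi using Nat.decreasingInduction with
    | self =>
      intro _
      rw [ha₁, div_self hnR.ne', hv₁]
      simp
    | of_succ i hi ih =>
      intro hδi
      have ih := ih (by push_cast; linarith)
      have hk : (0 : ℝ) < (i : ℝ) + 1 := by positivity
      have hx := div_mem_Icc hn0 hi.le hδi
      have hδi' : δ * n ≤ (i + 1 : ℕ) := by push_cast; linarith
      have hy := div_mem_Icc hn0 hi hδi'
      have hdiff : ((i + 1 : ℕ) : ℝ) / n - (i : ℝ) / n = 1 / n := by
        push_cast
        rw [← sub_div]
        ring
      have hxy : (i : ℝ) / n ≤ ((i + 1 : ℕ) : ℝ) / n := by gcongr; simp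
      have h1 := abs_sub_sub_mul_le hv hη' hx hy hxy (by rw [hdiff]; exact hnη)
      rw [hdiff] at h1
      have h2 := hn (i + 1) hi hδi'
      set y := ((i + 1 : ℕ) : ℝ) / n with hydef
      have h3 : max 0 (H y - θ * v y) / y * (1 / n) = max 0 (H y - θ * v y) / ((i : ℝ) + 1) := by
        rw [hydef]
        push_cast
        field_simp
      rw [h3] at h1
      have h4 := abs_add_max_div_sub_le (k := (i : ℝ) + 1) (a := a n (i + 1)) (a' := v y)
        (h := h n (i + 1)) (h' := H y) (by linarith [(Nat.cast_nonneg i : (0 : ℝ) ≤ i)]) hθ₀ hθ₁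
      rw [← ha n i hi] at h4
      have h5 := abs_sub_le (a n i) (v y + max 0 (H y - θ * v y) / ((i : ℝ) + 1)) (v ((i : ℝ) / n))
      rw [abs_sub_comm (v y + _) (v ((i : ℝ) / n))] at h5
      have h6 : |h n (i + 1) - H y| / ((i : ℝ) + 1) ≤ ε' / (δ * n) := by
        apply div_le_div₀ hε'0.le h2 (by positivity)
        linarith
      have h7 : ε' / (δ * n) + ε' * (1 / n) = ε / n := by
        rw [hε']
        field_simp
        ring
      have h8 : ((n : ℝ) - i) * (ε / n) = (n - (i + 1 : ℕ)) * (ε / n) + ε / n := by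
        push_cast
        ring
      rw [h8]
      linarith
  intro i hi hδi
  refine (main i hi hδi).trans ?_
  have : ((n : ℝ) - i) * (ε / n) = ε * ((n - i) / n) := by ring
  rw [this]
  refine mul_le_of_le_one_right hε.le ((div_le_one hnR).2 ?_)
  linarith [(Nat.cast_nonneg i : (0 : ℝ) ≤ i)]

/-- Existence of the solution of `v' x = - max 0 (h x - v x) / x` with `v 1 = 0`. -/
theorem exists_hasDerivWithinAt_neg_max_div {δ : ℝ} (hδ₀ : 0 < δ) (hδ₁ : δ ≤ 1) {h : ℝ → ℝ}
    (hh : ContinuousOn h (Icc δ 1)) :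
    ∃ v : ℝ → ℝ, v 1 = 0 ∧
      ∀ x ∈ Icc δ 1, HasDerivWithinAt v (-(max 0 (h x - v x) / x)) (Icc δ 1) x := by
  obtain ⟨M, hM⟩ := isCompact_Icc.exists_bound_of_continuousOn hh
  have hM0 : 0 ≤ M := (norm_nonneg _).trans (hM 1 (right_mem_Icc.2 hδ₁))
  -- Truncating `x` at `0` bounds the field by `M / δ` everywhere, so Picard–Lindelöf applies on all
  -- of `[δ, 1]`. The solution is decreasing and ends at `0`, hence nonnegative, so the truncation
  -- is finally removable.
  set F : ℝ → ℝ → ℝ := fun t x => -(max 0 (h t - max 0 x) / t) with hF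
  have hpl : IsPicardLindelof F (tmin := δ) (tmax := 1) ⟨1, right_mem_Icc.2 hδ₁⟩ 0
      ⟨M / δ * (1 - δ), by have := sub_nonneg.2 hδ₁; positivity⟩ 0
      ⟨M / δ, by positivity⟩ ⟨1 / δ, by positivity⟩ := by
    constructor
    · intro t ht
      have ht0 : 0 < t := hδ₀.trans_le ht.1
      refine LipschitzOnWith.of_dist_le_mul fun x _ y _ => ?_
      rw [Real.dist_eq, Real.dist_eq]
      have h1 : |max 0 (h t - max 0 x) - max 0 (h t - max 0 y)| ≤ |x - y| := by
        have h2 := abs_max_sub_max_le_abs (h t - max 0 x) (h t - max 0 y) 0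
        have h3 := abs_max_sub_max_le_abs x y 0
        rw [max_comm 0 (h t - max 0 x), max_comm 0 (h t - max 0 y)]
        rw [max_comm x 0, max_comm y 0] at h3
        refine h2.trans ?_
        rwa [sub_sub_sub_cancel_left, abs_sub_comm]
      have h4 : F t x - F t y = -((max 0 (h t - max 0 x) - max 0 (h t - max 0 y)) / t) := by
        simp only [hF]
        ring
      rw [h4, abs_neg, abs_div, abs_of_pos ht0]
      calc _ ≤ |x - y| / δ := div_le_div₀ (abs_nonneg _) h1 hδ₀ ht.1
        _ = 1 / δ * |x - y| := by ring
    · intro x _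
      refine (ContinuousOn.div ?_ continuousOn_id fun t ht => (hδ₀.trans_le ht.1).ne').neg
      exact ContinuousOn.sup continuousOn_const (hh.sub continuousOn_const)
    · intro t ht x _
      have ht0 : 0 < t := hδ₀.trans_le ht.1
      simp only [hF]
      rw [norm_neg, norm_div, Real.norm_eq_abs, Real.norm_eq_abs, abs_of_pos ht0,
        abs_of_nonneg (le_max_left _ _)]
      refine div_le_div₀ hM0 (max_le hM0 ?_) hδ₀ ht.1
      have := (le_abs_self (h t)).trans (hM t ht)
      linarith [le_max_left 0 x]
    · have : max (1 - (1 : ℝ)) (1 - δ) = 1 - δ := by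
        rw [sub_self]
        exact max_eq_right (sub_nonneg.2 hδ₁)
      change M / δ * max (1 - (1 : ℝ)) (1 - δ) ≤ M / δ * (1 - δ) - 0
      rw [this, sub_zero]
  obtain ⟨v, hv₁, hv⟩ := hpl.exists_eq_forall_mem_Icc_hasDerivWithinAt₀
  have hanti : AntitoneOn v (Icc δ 1) := by
    refine antitoneOn_of_hasDerivWithinAt_nonpos (convex_Icc δ 1)
      (fun x hx => (hv x hx).continuousWithinAt)
      (fun x hx => (hv x (interior_subset hx)).mono interior_subset) fun x hx => ?_
    have hx0 : 0 < x := hδ₀.trans_le (interior_subset hx).1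
    have := le_max_left 0 (h x - max 0 (v x))
    simp only [hF]
    rw [neg_nonpos]
    positivity
  refine ⟨v, hv₁, fun x hx => ?_⟩
  have h1 : 0 ≤ v x := by
    have := hanti hx (right_mem_Icc.2 hδ₁) hx.2
    simp only at hv₁
    rwa [hv₁] at this
  have := hv x hx
  simp only [hF, max_eq_right h1] at this
  exact this

/-- The solution with an unlimited number of choices. -/
lemma hasDerivWithinAt_integral_max_div {δ : ℝ} (hδ₀ : 0 < δ) {G : ℝ → ℝ}
    (hG : Continuous G) : ∀ x ∈ Icc δ 1,
      HasDerivWithinAt (fun x => ∫ y in x..1, max 0 (G y) / y) (-(max 0 (G x) / x)) (Icc δ 1) x := by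
  intro x hx
  have hx0 : 0 < x := hδ₀.trans_le hx.1
  have hc : ContinuousOn (fun y => max 0 (G y) / y) (Ioi 0) := by
    refine ContinuousOn.div ?_ continuousOn_id fun y hy => (mem_Ioi.1 hy).ne'
    exact (continuous_const.max hG).continuousOn
  refine HasDerivAt.hasDerivWithinAt ?_
  refine intervalIntegral.integral_hasDerivAt_left ?_ ?_ ?_
  · refine (hc.mono ?_).intervalIntegrable
    intro y hy
    rw [uIcc_of_le hx.2] at hy
    exact hx0.trans_le hy.1
  · exact hc.stronglyMeasurableAtFilter isOpen_Ioi x hx0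
  · exact hc.continuousAt (Ioi_mem_nhds hx0)

end DurationProblem

/-! ### The two roots, the explicit integral and the passage to the limit -/

namespace DurationProblem

open Filter Set Topology

lemma strictMonoOn_negMulLog : StrictMonoOn Real.negMulLog (Icc 0 (Real.exp (-1))) := by
  refine strictMonoOn_of_deriv_pos (convex_Icc _ _) Real.continuous_negMulLog.continuousOn ?_
  intro x hx
  rw [interior_Icc] at hx
  rw [Real.deriv_negMulLog hx.1.ne']
  have := Real.log_lt_log hx.1 hx.2
  rw [Real.log_exp] at this
  linarith

lemma strictAntiOn_negMulLog : StrictAntiOn Real.negMulLog (Ici (Real.exp (-1))) := by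
  refine strictAntiOn_of_deriv_neg (convex_Ici _) Real.continuous_negMulLog.continuousOn ?_
  intro x hx
  rw [interior_Ici] at hx
  have h0 := Real.exp_pos (-1)
  rw [Real.deriv_negMulLog (h0.trans hx).ne']
  have := Real.log_lt_log h0 hx
  rw [Real.log_exp] at this
  linarith

lemma negMulLog_exp_neg_one : Real.negMulLog (Real.exp (-1)) = Real.exp (-1) := by
  simp [Real.negMulLog]

lemma existsUnique_negMulLog_eq_right {c : ℝ} (hc0 : 0 < c) (hc : c ≤ Real.exp (-1)) :
    ∃! β : ℝ, β ∈ Ico (Real.exp (-1)) 1 ∧ -β * Real.log β = c := by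
  have he : Real.exp (-1) ≤ 1 := by simp
  obtain ⟨β, hβ, hβc⟩ := intermediate_value_Icc' he Real.continuous_negMulLog.continuousOn
    (show c ∈ Icc (Real.negMulLog 1) (Real.negMulLog (Real.exp (-1))) by
      rw [negMulLog_exp_neg_one, Real.negMulLog_one]
      exact ⟨hc0.le, hc⟩)
  refine ⟨β, ⟨⟨hβ.1, hβ.2.lt_of_ne ?_⟩, hβc⟩, ?_⟩
  · rintro rfl
    rw [Real.negMulLog_one] at hβc
    exact hc0.ne hβc
  · rintro y ⟨hy, hyc⟩
    exact strictAntiOn_negMulLog.injOn hy.1 hβ.1 (hyc.trans hβc.symm)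

lemma existsUnique_negMulLog_eq_left {c : ℝ} (hc0 : 0 < c) (hc : c ≤ Real.exp (-1)) :
    ∃! β : ℝ, β ∈ Ioc 0 (Real.exp (-1)) ∧ -β * Real.log β = c := by
  obtain ⟨β, hβ, hβc⟩ := intermediate_value_Icc (Real.exp_pos (-1)).le
    Real.continuous_negMulLog.continuousOn
    (show c ∈ Icc (Real.negMulLog 0) (Real.negMulLog (Real.exp (-1))) by
      rw [negMulLog_exp_neg_one, Real.negMulLog_zero]
      exact ⟨hc0.le, hc⟩)
  refine ⟨β, ⟨⟨hβ.1.lt_of_ne ?_, hβ.2⟩, hβc⟩, ?_⟩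
  · rintro rfl
    rw [Real.negMulLog_zero] at hβc
    exact hc0.ne hβc
  · rintro y ⟨hy, hyc⟩
    exact strictMonoOn_negMulLog.injOn (Ioc_subset_Icc_self hy) hβ (hyc.trans hβc.symm)

/-- Since `negMulLog` increases up to `exp (-1)` and decreases afterwards, the integrand is
supported in `[β', β]`, where `y - y log y - c log y` is an antiderivative. The root equations `log
β = -c / β` and `log β' = -c / β'` eliminate the logarithms. -/
lemma integral_max_div_eq {c β β' δ : ℝ} (hδ₀ : 0 < δ) (hδ : δ ≤ β')
    (hβ : β ∈ Ico (Real.exp (-1)) 1) (hβc : -β * Real.log β = c)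
    (hβ' : β' ∈ Ioc 0 (Real.exp (-1))) (hβ'c : -β' * Real.log β' = c) :
    ∫ y in δ..1, max 0 (Real.negMulLog y - c) / y = (β - β') * (1 - c ^ 2 / (β * β')) := by
  have hβ0 : 0 < β := (Real.exp_pos _).trans_le hβ.1
  have hle : β' ≤ β := hβ'.2.trans hβ.1
  have hβm : Real.negMulLog β = c := hβc
  have hβ'm : Real.negMulLog β' = c := hβ'c
  have hint : ∀ a b : ℝ, 0 < a → a ≤ b →
      IntervalIntegrable (fun y => max 0 (Real.negMulLog y - c) / y) MeasureTheory.volume a b := by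
    intro a b ha hab
    refine ContinuousOn.intervalIntegrable ?_
    rw [uIcc_of_le hab]
    refine ContinuousOn.div ?_ continuousOn_id fun y hy => (ha.trans_le hy.1).ne'
    exact (continuous_const.max (Real.continuous_negMulLog.sub continuous_const)).continuousOn
  have h1 : ∫ y in δ..β', max 0 (Real.negMulLog y - c) / y = 0 := by
    refine (intervalIntegral.integral_congr fun y hy => ?_).trans
      (intervalIntegral.integral_zero (a := δ) (b := β'))
    rw [uIcc_of_le hδ] at hy
    have := strictMonoOn_negMulLog.monotoneOn ⟨hδ₀.le.trans hy.1, hy.2.trans hβ'.2⟩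
      (Ioc_subset_Icc_self hβ') hy.2
    rw [max_eq_left (by linarith), zero_div]
  have h3 : ∫ y in β..1, max 0 (Real.negMulLog y - c) / y = 0 := by
    refine (intervalIntegral.integral_congr fun y hy => ?_).trans
      (intervalIntegral.integral_zero (a := β) (b := 1))
    rw [uIcc_of_le hβ.2.le] at hy
    have := strictAntiOn_negMulLog.antitoneOn hβ.1 (hβ.1.trans hy.1) hy.1
    rw [max_eq_left (by linarith), zero_div]
  have h2 : ∫ y in β'..β, max 0 (Real.negMulLog y - c) / y =
      (β + Real.negMulLog β - c * Real.log β) - (β' + Real.negMulLog β' - c * Real.log β') := by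
    refine intervalIntegral.integral_eq_sub_of_hasDerivAt
      (f := fun y => y + Real.negMulLog y - c * Real.log y) (fun y hy => ?_)
      (hint β' β hβ'.1 hle)
    rw [uIcc_of_le hle] at hy
    have hy0 : 0 < y := hβ'.1.trans_le hy.1
    have hG : 0 ≤ Real.negMulLog y - c := by
      rcases le_total y (Real.exp (-1)) with h | h
      · have := strictMonoOn_negMulLog.monotoneOn (Ioc_subset_Icc_self hβ') ⟨hy0.le, h⟩ hy.1
        linarith
      · have := strictAntiOn_negMulLog.antitoneOn h hβ.1 hy.2
        linarith
    rw [max_eq_right hG]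
    have hd := ((hasDerivAt_id y).add (Real.hasDerivAt_negMulLog hy0.ne')).sub
      ((Real.hasDerivAt_log hy0.ne').const_mul c)
    refine hd.congr_deriv ?_
    rw [Real.negMulLog]
    field_simp
    ring
  rw [← intervalIntegral.integral_add_adjacent_intervals (hint δ β' hδ₀ hδ)
      (hint β' 1 hβ'.1 (hle.trans hβ.2.le)),
    ← intervalIntegral.integral_add_adjacent_intervals (hint β' β hβ'.1 hle)
      (hint β 1 hβ0 hβ.2.le), h1, h2, h3, hβm, hβ'm]
  have hl : Real.log β = -c / β := by
    rw [eq_div_iff hβ0.ne']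
    linarith
  have hl' : Real.log β' = -c / β' := by
    rw [eq_div_iff hβ'.1.ne']
    linarith
  rw [hl, hl']
  have h4 := hβ'.1.ne'
  field_simp
  ring

/-- The shift `i - 1` matches the scheme, which pairs the payoff at time `i` with the grid point `(i
+ 1) / n`. The subtraction never truncates, as `δ * n ≤ i` forces `i > 0`. -/
lemma gridConverges_payoff {δ c : ℝ} (hδ₀ : 0 < δ) {cost : ℕ → ℝ}
    (hcost : Tendsto (fun n : ℕ => cost n / (n : ℝ)) atTop (𝓝 c)) :
    GridConverges δ (fun n i => (expectedDuration n (i - 1) - cost n) / n)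
      fun x => Real.negMulLog x - c := by
  intro ε hε
  have h1 := Metric.tendsto_nhds.1 hcost (ε / 2) (half_pos hε)
  have h2 : ∀ᶠ n : ℕ in atTop, 1 / (n : ℝ) < ε / 2 :=
    (tendsto_one_div_atTop_nhds_zero_nat (𝕜 := ℝ)).eventually_lt_const (half_pos hε)
  filter_upwards [h1, h2, eventually_gt_atTop 0] with n h1 h2 hn i hi hδ
  have hn' : (0 : ℝ) < n := by exact_mod_cast hn
  have hi0 : (0 : ℝ) < i := (mul_pos hδ₀ hn').trans_le hδ
  obtain ⟨k, rfl⟩ := Nat.exists_eq_add_one_of_ne_zero (Nat.cast_pos.1 hi0).ne'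
  obtain ⟨h3, h4⟩ := expectedDuration_div_bounds (show k < n from hi)
  rw [Real.dist_eq] at h1
  rw [Nat.add_sub_cancel, sub_div]
  push_cast
  rw [abs_lt] at h1
  rw [abs_le]
  constructor <;> linarith

lemma max_zero_div (x : ℝ) (n : ℕ) : max 0 (x / n) = max 0 x / n := by
  rw [← max_div_div_right n.cast_nonneg, zero_div]

lemma value_div_eq (g : ℕ → ℝ) {n i : ℕ} (l : ℕ) (hi : i < n) :
    value g n (l + 1) i / n = value g n (l + 1) (i + 1) / n +
      max 0 (g i / n + value g n l (i + 1) / n - value g n (l + 1) (i + 1) / n) /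
        ((i : ℝ) + 1) := by
  rw [value_succ g l hi, ← add_div, ← sub_div, max_zero_div]
  ring

lemma unlimitedValue_div_eq (g : ℕ → ℝ) {n i : ℕ} (hi : i < n) :
    unlimitedValue g n i / n = unlimitedValue g n (i + 1) / n +
      max 0 (g i / n) / ((i : ℝ) + 1) := by
  rw [unlimitedValue_step g hi, max_zero_div]
  ring

/-- The scaled values converge on the grid to a continuous function. -/
lemma exists_gridConverges_value {δ c : ℝ} (hδ₀ : 0 < δ) (hδ₁ : δ ≤ 1) {cost : ℕ → ℝ}
    (hcost : Tendsto (fun n : ℕ => cost n / (n : ℝ)) atTop (𝓝 c)) (l : ℕ) :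
    ∃ v : ℝ → ℝ, ContinuousOn v (Icc δ 1) ∧
      GridConverges δ (fun n i => value (fun i => expectedDuration n i - cost n) n l i / n) v := by
  induction l with
  | zero =>
    refine ⟨fun _ => 0, continuousOn_const, ?_⟩
    simpa only [value_zero, zero_div] using gridConverges_zero δ
  | succ l ih =>
    obtain ⟨w, hwc, hw⟩ := ih
    have hH : ContinuousOn (fun x => Real.negMulLog x - c + w x) (Icc δ 1) :=
      (Real.continuous_negMulLog.sub continuous_const).continuousOn.add hwc
    obtain ⟨v, hv₁, hv⟩ := exists_hasDerivWithinAt_neg_max_div hδ₀ hδ₁ hH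
    refine ⟨v, fun x hx => (hv x hx).continuousWithinAt, ?_⟩
    -- The limit `w` at level `l` enters as data for level `l + 1`; `θ = 1` keeps the opportunity
    -- cost of a choice, whereas the unlimited problem has `θ = 0`.
    refine gridConverges_of_recursion (θ := 1) hδ₀ zero_le_one le_rfl hH
      (by simpa only [one_mul] using hv) hv₁ ((gridConverges_payoff hδ₀ hcost).add hw) ?_ ?_
    · intro n
      rw [value_end, zero_div]
    · intro n i hi
      rw [value_div_eq _ l hi, one_mul]
      rfl

lemma gridConverges_unlimitedValue {δ c : ℝ} (hδ₀ : 0 < δ) {cost : ℕ → ℝ}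
    (hcost : Tendsto (fun n : ℕ => cost n / (n : ℝ)) atTop (𝓝 c)) :
    GridConverges δ
      (fun n i => unlimitedValue (fun i => expectedDuration n i - cost n) n i / n)
      fun x => ∫ y in x..1, max 0 (Real.negMulLog y - c) / y := by
  have hG : Continuous fun x => Real.negMulLog x - c :=
    Real.continuous_negMulLog.sub continuous_const
  refine gridConverges_of_recursion (θ := 0) hδ₀ le_rfl zero_le_one hG.continuousOn
    (by simpa only [zero_mul, sub_zero] using hasDerivWithinAt_integral_max_div hδ₀ hG)
    intervalIntegral.integral_same (gridConverges_payoff hδ₀ hcost) ?_ ?_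
  · intro n
    rw [unlimitedValue_end, zero_div]
  · intro n i hi
    rw [unlimitedValue_div_eq _ hi, zero_mul, sub_zero]
    rfl

lemma ceil_mul_le {δ : ℝ} (hδ₁ : δ ≤ 1) (n : ℕ) : ⌈δ * n⌉₊ ≤ n := by
  rw [Nat.ceil_le]
  exact mul_le_of_le_one_left n.cast_nonneg hδ₁

/-- Early choices do not pay. -/
lemma eventually_optimalNetPayoff_eq {δ ρ c : ℝ} (hδ₀ : 0 < δ) (hδρ : δ < ρ)
    (hρ : ρ ≤ Real.exp (-1)) (hρc : Real.negMulLog ρ < c) {cost : ℕ → ℝ}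
    (hcost : Tendsto (fun n : ℕ => cost n / (n : ℝ)) atTop (𝓝 c)) (m : ℕ) :
    ∀ᶠ n : ℕ in atTop, optimalNetPayoff n m (cost n) =
      value (fun i => expectedDuration n i - cost n) n m ⌈δ * n⌉₊ := by
  have hδ₁ : δ ≤ 1 := by
    have : Real.exp (-1) ≤ 1 := by simp
    linarith
  -- Half of the gap absorbs the error of `cost n / n`, the other half the `1 / n` in the duration
  -- bound; the room between `δ` and `ρ` absorbs the shift to `(i + 1) / n`.
  set ε := (c - Real.negMulLog ρ) / 2 with hε
  have hε0 : 0 < ε := by rw [hε]; linarith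
  have hinv := tendsto_one_div_atTop_nhds_zero_nat (𝕜 := ℝ)
  filter_upwards [hcost.eventually_const_lt (show c - ε < c by linarith),
    hinv.eventually_lt_const hε0, hinv.eventually_lt_const (sub_pos.2 hδρ),
    eventually_gt_atTop 0] with n h1 h2 h3 hn
  have hn' : (0 : ℝ) < n := by exact_mod_cast hn
  rw [optimalNetPayoff_eq_value]
  refine value_eq_of_nonpos _ m (ceil_mul_le hδ₁ n) fun i hi => ?_
  have hin : i < n := hi.trans_le (ceil_mul_le hδ₁ n)
  have hi' : (i : ℝ) < δ * n := Nat.lt_ceil.1 hi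
  have hx : ((i : ℝ) + 1) / n ≤ ρ := by
    rw [div_lt_iff₀ hn'] at h3
    rw [div_le_iff₀ hn']
    linarith
  have hx0 : 0 ≤ ((i : ℝ) + 1) / n := by positivity
  have h4 := strictMonoOn_negMulLog.monotoneOn ⟨hx0, hx.trans hρ⟩ ⟨hδ₀.le.trans hδρ.le, hρ⟩ hx
  have h5 := (expectedDuration_div_bounds hin).2
  have h6 : expectedDuration n i / n ≤ cost n / n := by linarith
  rw [div_le_div_iff_of_pos_right hn'] at h6
  linarith

/-- A bound independent of `n` is what lets the factorial deficit estimate pass to the limit. -/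
lemma harmonicTail_ceil_le {δ : ℝ} (hδ₀ : 0 < δ) (hδ₁ : δ ≤ 1) (n : ℕ) :
    harmonicTail n ⌈δ * n⌉₊ ≤ Real.log (1 / δ) + 1 := by
  rcases (ceil_mul_le hδ₁ n).eq_or_lt with h | h
  · rw [h]
    have : 0 ≤ Real.log (1 / δ) := Real.log_nonneg ((one_le_div hδ₀).2 hδ₁)
    simp only [harmonicTail, Finset.Ico_self, Finset.sum_empty]
    linarith
  · have hn' : (0 : ℝ) < n := by exact_mod_cast (Nat.zero_le _).trans_lt h
    have hk : (0 : ℝ) < (⌈δ * n⌉₊ : ℝ) + 1 := by positivity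
    refine (harmonicTail_bounds h).2.trans (add_le_add ?_ ?_)
    · refine Real.log_le_log (by positivity) ?_
      rw [div_le_div_iff₀ hk hδ₀]
      linarith [Nat.le_ceil (δ * n)]
    · rw [div_le_one hk]
      simp

end DurationProblem

theorem lemma8 (c : ℝ) (hc0 : 0 < c) (hc : c ≤ Real.exp (-1))
    (cost : ℕ → ℝ)
    (hcost : Filter.Tendsto (fun n : ℕ => cost n / (n : ℝ)) Filter.atTop (nhds c)) :
    (∃! β : ℝ, β ∈ Set.Ico (Real.exp (-1)) 1 ∧ -β * Real.log β = c) ∧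
    (∃! β' : ℝ, β' ∈ Set.Ioc 0 (Real.exp (-1)) ∧ -β' * Real.log β' = c) ∧
    ∀ β β' : ℝ,
      β ∈ Set.Ico (Real.exp (-1)) 1 → -β * Real.log β = c →
      β' ∈ Set.Ioc 0 (Real.exp (-1)) → -β' * Real.log β' = c →
      ∃ q : ℕ → ℝ,
        (∀ m : ℕ, Filter.Tendsto
          (fun n : ℕ => DurationProblem.optimalNetPayoff n m (cost n) / (n : ℝ))
          Filter.atTop (nhds (q m))) ∧
        Filter.Tendsto q Filter.atTop (nhds ((β - β') * (1 - c ^ 2 / (β * β')))) := by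
  open DurationProblem Filter Topology Set in
  refine ⟨existsUnique_negMulLog_eq_right hc0 hc, existsUnique_negMulLog_eq_left hc0 hc, ?_⟩
  intro β β' hβ hβc hβ' hβ'c
  have hβ'0 := hβ'.1
  have he : Real.exp (-1) ≤ 1 := by simp
  -- Any `δ < ρ < β'` would do; here `ρ = β' / 2`. The same `δ` serves every `m`.
  obtain ⟨δ, hδ⟩ : ∃ δ, δ = β' / 4 := ⟨_, rfl⟩
  have hδ₀ : 0 < δ := by rw [hδ]; positivity
  have hδβ' : δ ≤ β' := by rw [hδ]; linarith
  have hδ₁ : δ ≤ 1 := hδβ'.trans (hβ'.2.trans he)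
  have hδρ : δ < β' / 2 := by rw [hδ]; linarith
  have hρ : β' / 2 ≤ Real.exp (-1) := by linarith [hβ'.2]
  have hρc : Real.negMulLog (β' / 2) < c :=
    lt_of_lt_of_eq (strictMonoOn_negMulLog ⟨by positivity, hρ⟩ (Ioc_subset_Icc_self hβ')
      (half_lt_self hβ'0)) hβ'c
  choose v hvc hv using exists_gridConverges_value hδ₀ hδ₁ hcost
  have hV := fun m => (hv m).tendsto hδ₀.le hδ₁ (hvc m)
  have hG : Continuous fun x => Real.negMulLog x - c :=
    Real.continuous_negMulLog.sub continuous_const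
  have hU := (gridConverges_unlimitedValue hδ₀ hcost).tendsto hδ₀.le hδ₁
    fun x hx => (hasDerivWithinAt_integral_max_div hδ₀ hG x hx).continuousWithinAt
  rw [integral_max_div_eq hδ₀ hδβ' hβ hβc hβ' hβ'c] at hU
  set Q := (β - β') * (1 - c ^ 2 / (β * β'))
  refine ⟨fun m => v m δ, fun m => (hV m).congr' ?_, ?_⟩
  · filter_upwards [eventually_optimalNetPayoff_eq hδ₀ hδρ hρ hρc hcost m] with n hn
    rw [hn]
  -- Sandwich between `Q * (1 - L ^ m / m!)` and `Q`, with `L = log (1 / δ) + 1`; both bounds are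
  -- limits in `n` of the finite estimates.
  · have hlow : ∀ m, v m δ ≤ Q := fun m => le_of_tendsto_of_tendsto' (hV m) hU fun n => by
      have := value_le_unlimitedValue (fun i => expectedDuration n i - cost n) m
        (ceil_mul_le hδ₁ n)
      gcongr
    have hup : ∀ m, Q - Q * ((Real.log (1 / δ) + 1) ^ m / (m.factorial : ℝ)) ≤ v m δ := by
      intro m
      refine le_of_tendsto_of_tendsto' (hU.sub (hU.mul_const _)) (hV m) fun n => ?_
      have h1 := unlimitedValue_sub_value_le (fun i => expectedDuration n i - cost n) m le_rfl
        (ceil_mul_le hδ₁ n)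
      have h2 := unlimitedValue_nonneg (fun i => expectedDuration n i - cost n) n ⌈δ * n⌉₊
      have h3 := harmonicTail_ceil_le hδ₀ hδ₁ n
      have h4 := harmonicTail_nonneg n ⌈δ * n⌉₊
      have h5 : unlimitedValue (fun i => expectedDuration n i - cost n) n ⌈δ * n⌉₊ *
          (harmonicTail n ⌈δ * n⌉₊ ^ m / (m.factorial : ℝ)) ≤
          unlimitedValue (fun i => expectedDuration n i - cost n) n ⌈δ * n⌉₊ *
          ((Real.log (1 / δ) + 1) ^ m / (m.factorial : ℝ)) := by gcongr
      have h6 := div_le_div_of_nonneg_right (h1.trans h5) (n.cast_nonneg : (0 : ℝ) ≤ n)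
      rw [sub_div, mul_div_right_comm] at h6
      linarith
    refine tendsto_of_tendsto_of_tendsto_of_le_of_le ?_ tendsto_const_nhds hup hlow
    have := (FloorSemiring.tendsto_pow_div_factorial_atTop (Real.log (1 / δ) + 1)).const_mul Q
    simpa using this.const_sub Q
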